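/- An instance of the Group Activity Selection Problem with graph structure (gGASP) consists of a set of players $N=[n]$, a set of activities $A=A^*\cup\{a_\emptyset\}$ with $A^*=\{a_1,\dots,a_p\}$ and $a_\emptyset$ the void activity, for every player $i$ a complete and transitive preference relation $\succeq_i$ on the alternatives $(A^*\times[n])\cup\{(a_\emptyset,1)\}$, and an undirected graph $(N,L)$. Activities $a,b\in A^*$ are equivalent if every player is indifferent between $(a,\ell)$ and $(b,\ell)$ for all $\ell\in[n]$; $a\in A^*$ is copyable if at least $n$ activities of $A^*$ (including $a$) are equivalent to $a$. For an assignment $\pi:N\to A$ and $a\in A^*$ let $\pi^a=\{i\in N:\pi(i)=a\}$, and let $\pi_i=\{j\in N:\pi(j)=\pi(i)\}$ if $\pi(i)\ne a_\emptyset$ and $\pi_i=\{i\}$ otherwise. A set of players is feasible if it is connected in $(N,L)$, and $\pi$ is feasible if $\pi_i$ is feasible for every $i\in N$. An assignment $\pi$ is individually stable if (1) it is individually rational, i.e. $(\pi(i),|\pi_i|)\succeq_i(a_\emptyset,1)$ for every $i$ with $\pi(i)\neq a_\emptyset$, and (2) there are no player $i$ and activity $a\in A^*$ with $\pi(i)\ne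 a$ such that $\pi^a\cup\{i\}$ is feasible, $(a,|\pi^a|+1)\succ_i(\pi(i),|\pi_i|)$, and $(a,|\pi^a|+1)\succeq_j(a,|\pi^a|)$ for all $j\in\pi^a$. **Theorem.** Every gGASP instance in which each activity $a\in A^*$ is copyable and $(N,L)$ is acyclic admits an individually stable feasible assignment. Moreover, such an assignment can be found in time polynomial in $p$ and $n$: there are a single program and a polynomial $P$ such that on every such instance the program halts within $P(p,n)$ steps and outputs an individually stable feasible assignment. Here programs are random access programs over natural-number variables and arrays, with unit-cost addition, truncated subtraction, comparison and array access, which are given $n$ and $p$ and can query in unit time whether player $i$ weakly prefers one alternative to another and whether two players are linked. -/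

import Mathlib

/-! ## Group activity selection problems on a social network -/

/-- The alternatives `(A* × [n]) ∪ {(a_∅, 1)}` for `n` players and `p` non-void activities.
Non-void activities are `some a` with `a : Fin p`; the void activity `a_∅` is `none`. -/
def GGASP.alternatives (n p : ℕ) : Set (Option (Fin p) × ℕ) :=
  {x | (x.1 ≠ none ∧ 1 ≤ x.2 ∧ x.2 ≤ n) ∨ x = (none, 1)}

/-- An instance of the group activity selection problem with graph structure, with set of players
`Fin n`, set of activities `Option (Fin p)`, a complete and transitive preference relation of every
player over the alternatives, and a network of communication links.
`weakPref i x y` says that player `i` weakly prefers `x` to `y`; it is meaningful only when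
`x` and `y` are alternatives. -/
structure GGASP (n p : ℕ) where
  weakPref : Fin n → Option (Fin p) × ℕ → Option (Fin p) × ℕ → Prop
  complete : ∀ i, ∀ x ∈ GGASP.alternatives n p, ∀ y ∈ GGASP.alternatives n p,
    weakPref i x y ∨ weakPref i y x
  transitive : ∀ i, ∀ x ∈ GGASP.alternatives n p, ∀ y ∈ GGASP.alternatives n p,
    ∀ z ∈ GGASP.alternatives n p, weakPref i x y → weakPref i y z → weakPref i x z
  network : SimpleGraph (Fin n)

namespace GGASP

variable {n p : ℕ}

/-- Player `i` strictly prefers `x` to `y`. -/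
def StrictPref (I : GGASP n p) (i : Fin n) (x y : Option (Fin p) × ℕ) : Prop :=
  I.weakPref i x y ∧ ¬ I.weakPref i y x

/-- Player `i` is indifferent between `x` and `y`. -/
def Indifferent (I : GGASP n p) (i : Fin n) (x y : Option (Fin p) × ℕ) : Prop :=
  I.weakPref i x y ∧ I.weakPref i y x

/-- Two non-void activities are equivalent if every player is indifferent between them
at every group size in `[n]`. -/
def Equivalent (I : GGASP n p) (a b : Fin p) : Prop :=
  ∀ i : Fin n, ∀ l : ℕ, 1 ≤ l → l ≤ n → I.Indifferent i (some a, l) (some b, l)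

/-- A non-void activity is copyable if at least `n` non-void activities (itself included)
are equivalent to it. -/
def Copyable (I : GGASP n p) (a : Fin p) : Prop :=
  n ≤ {b : Fin p | I.Equivalent a b}.ncard

/-- The set `π^a` of players assigned to the non-void activity `a`. -/
def group (π : Fin n → Option (Fin p)) (a : Fin p) : Finset (Fin n) :=
  Finset.univ.filter fun j => π j = some a

/-- The coalition `π_i` of player `i`: a player assigned to the void activity is alone. -/
def coalition (π : Fin n → Option (Fin p)) (i : Fin n) : Finset (Fin n) :=
  if π i = none then {i} else Finset.univ.filter fun j => π j = π i

/-- The alternative `(π(i), |π_i|)` that player `i` gets under `π`. -/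
def outcome (π : Fin n → Option (Fin p)) (i : Fin n) : Option (Fin p) × ℕ :=
  (π i, (coalition π i).card)

/-- A coalition is feasible if it is connected in the network. -/
def FeasibleCoalition (I : GGASP n p) (S : Finset (Fin n)) : Prop :=
  (I.network.induce (S : Set (Fin n))).Preconnected

/-- A feasible assignment: all its coalitions are feasible. -/
def FeasibleAssignment (I : GGASP n p) (π : Fin n → Option (Fin p)) : Prop :=
  ∀ i : Fin n, I.FeasibleCoalition (coalition π i)

/-- Individual rationality. -/
def IndividuallyRational (I : GGASP n p) (π : Fin n → Option (Fin p)) : Prop :=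
  ∀ i : Fin n, π i ≠ none → I.weakPref i (outcome π i) (none, 1)

/-- Player `i`, who is not engaged in `a`, strictly prefers to join the group `π^a`. -/
def NSDeviation (I : GGASP n p) (π : Fin n → Option (Fin p)) (i : Fin n) (a : Fin p) : Prop :=
  π i ≠ some a ∧ I.StrictPref i (some a, (group π a).card + 1) (outcome π i)

/-- An NS-deviation that all members of the group joined accept. -/
def ISDeviation (I : GGASP n p) (π : Fin n → Option (Fin p)) (i : Fin n) (a : Fin p) : Prop :=
  I.NSDeviation π i a ∧ ∀ j ∈ group π a,
    I.weakPref j (some a, (group π a).card + 1) (some a, (group π a).card)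

/-- Individual stability on the network: individual rationality, and no player has an
IS-deviation that is feasible, i.e. for which the enlarged group is feasible. -/
def IndividuallyStable (I : GGASP n p) (π : Fin n → Option (Fin p)) : Prop :=
  I.IndividuallyRational π ∧
    ∀ (i : Fin n) (a : Fin p), I.FeasibleCoalition (insert i (group π a)) → ¬ I.ISDeviation π i a

/-- All activities are copyable and the network is a forest. -/
def CopyableAcyclic (I : GGASP n p) : Prop :=
  (∀ a : Fin p, I.Copyable a) ∧ I.network.IsAcyclic

end GGASP

/-! ## Random access programs with unit-cost instructions

Programs work on natural-number variables and arrays. The only arithmetic is addition and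
truncated subtraction (a unit-cost multiplication would be too strong). Every operation occurring
in an evaluated expression, and every command executed, costs one time unit. -/

namespace RAM

/-- A memory state: scalar variables and arrays, both named by natural numbers. -/
structure State where
  var : ℕ → ℕ
  arr : ℕ → ℕ → ℕ

/-- The access that a program has to its input, apart from `n` and `p`:
preference comparisons and adjacency tests. -/
structure Oracle where
  pref : ℕ → ℕ → ℕ → ℕ → ℕ → Prop
  adj : ℕ → ℕ → Prop

/-- Expressions; tests have value `1` (true) or `0` (false). -/
inductive Expr where
  | const (c : ℕ)
  | var (x : ℕ)
  | get (a : ℕ) (e : Expr)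
  | add (e f : Expr)
  | sub (e f : Expr)
  | le (e f : Expr)
  | eq (e f : Expr)
  | pref (i a k b l : Expr)
  | adj (i j : Expr)

open Classical in
/-- The value of an expression. -/
noncomputable def Expr.eval (O : Oracle) (s : State) : Expr → ℕ
  | .const c => c
  | .var x => s.var x
  | .get a e => s.arr a (e.eval O s)
  | .add e f => e.eval O s + f.eval O s
  | .sub e f => e.eval O s - f.eval O s
  | .le e f => if e.eval O s ≤ f.eval O s then 1 else 0
  | .eq e f => if e.eval O s = f.eval O s then 1 else 0
  | .pref i a k b l =>
      if O.pref (i.eval O s) (a.eval O s) (k.eval O s) (b.eval O s) (l.eval O s) then 1 else 0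
  | .adj i j => if O.adj (i.eval O s) (j.eval O s) then 1 else 0

/-- The time to evaluate an expression: one unit for each of its nodes. -/
def Expr.time : Expr → ℕ
  | .const _ => 1
  | .var _ => 1
  | .get _ e => e.time + 1
  | .add e f => e.time + f.time + 1
  | .sub e f => e.time + f.time + 1
  | .le e f => e.time + f.time + 1
  | .eq e f => e.time + f.time + 1
  | .pref i a k b l => i.time + a.time + k.time + b.time + l.time + 1
  | .adj i j => i.time + j.time + 1

/-- Programs. -/
inductive Prog where
  | skip
  | assign (x : ℕ) (e : Expr)
  | store (a : ℕ) (idx e : Expr)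
  | seq (c d : Prog)
  | ite (e : Expr) (c d : Prog)
  | while (e : Expr) (c : Prog)

/-- `Exec O c s t s'`: program `c`, started in state `s`, halts in state `s'` after exactly
`t` time units. -/
inductive Exec (O : Oracle) : Prog → State → ℕ → State → Prop
  | skip (s : State) : Exec O .skip s 1 s
  | assign (s : State) (x : ℕ) (e : Expr) :
      Exec O (.assign x e) s (e.time + 1) { s with var := Function.update s.var x (e.eval O s) }
  | store (s : State) (a : ℕ) (idx e : Expr) :
      Exec O (.store a idx e) s (idx.time + e.time + 1)
        { s with arr := Function.update s.arr a
                          (Function.update (s.arr a) (idx.eval O s) (e.eval O s)) }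
  | seq (c d : Prog) (s s' s'' : State) (t u : ℕ) :
      Exec O c s t s' → Exec O d s' u s'' → Exec O (.seq c d) s (t + u) s''
  | ite_true (e : Expr) (c d : Prog) (s s' : State) (t : ℕ) :
      e.eval O s ≠ 0 → Exec O c s t s' → Exec O (.ite e c d) s (e.time + t + 1) s'
  | ite_false (e : Expr) (c d : Prog) (s s' : State) (t : ℕ) :
      e.eval O s = 0 → Exec O d s t s' → Exec O (.ite e c d) s (e.time + t + 1) s'
  | while_true (e : Expr) (c : Prog) (s s' s'' : State) (t u : ℕ) :
      e.eval O s ≠ 0 → Exec O c s t s' → Exec O (.while e c) s' u s'' →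
      Exec O (.while e c) s (e.time + t + u + 1) s''
  | while_false (e : Expr) (c : Prog) (s : State) :
      e.eval O s = 0 → Exec O (.while e c) s (e.time + 1) s

end RAM

namespace GGASP

variable {n p : ℕ}

/-- The number by which programs refer to an activity: `0` for the void activity and
`1, …, p` for the others. -/
def activityCode : Option (Fin p) → ℕ
  | none => 0
  | some a => a.val + 1

/-- The queries to an instance: whether player `i` weakly prefers the alternative `(a, k)` to the
alternative `(b, l)`, and whether players `i` and `j` are linked. Players are `0, …, n - 1`.
Queries that are not of this form are answered negatively. -/
def oracle (I : GGASP n p) : RAM.Oracle where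
  pref i a k b l := ∃ (i' : Fin n) (a' b' : Option (Fin p)),
    i'.val = i ∧ activityCode a' = a ∧ activityCode b' = b ∧
    (a', k) ∈ alternatives n p ∧ (b', l) ∈ alternatives n p ∧ I.weakPref i' (a', k) (b', l)
  adj i j := ∃ i' j' : Fin n, i'.val = i ∧ j'.val = j ∧ I.network.Adj i' j'

/-- The initial state: variable `0` holds `n`, variable `1` holds `p`, all else is `0`. -/
def initState (n p : ℕ) : RAM.State where
  var x := if x = 0 then n else if x = 1 then p else 0
  arr _ _ := 0

/-- Program `c` run on the instance `I` halts after `t` time units with the assignment `π`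
written in array `0`. -/
def Computes (c : RAM.Prog) (I : GGASP n p) (t : ℕ) (π : Fin n → Option (Fin p)) : Prop :=
  ∃ s : RAM.State, RAM.Exec I.oracle c (initState n p) t s ∧
    ∀ i : Fin n, s.arr 0 i.val = activityCode (π i)

end GGASP

/-! In a forest every nonempty set of vertices has a member with at most one neighbour in that set.
Hence the players can be processed one at a time so that each has, at its turn, at most one
unprocessed neighbour, its parent; labels decrease along this order. Every processed player `i`
keeps a tentative team: a connected set of processed players with top `i`, together with an
activity.

When `i` is processed, it picks a best alternative among being alone, starting an unused activity
alone, and joining the team of a child that accepts one more member. Fewer than `n` activities are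
in use at that moment, while copyability gives `n` equivalents of every activity, so some equivalent
is unused and the choice is at least as good for `i` as any activity performed alone
(`Plan.Valid.exists_unused`). The team then absorbs, one after another, adjacent players who
strictly prefer joining it to the alternative of their own team, as long as all members accept
(`Plan.Growing.insert`). So every member likes a team at least as much as the team of which it is
the top itself.

Once all players are processed, they are visited from the last processed to the first, and each
player still unassigned has its whole team assigned (`Plan.Assigning.assign`). These teams partition
the players. Teams with the same activity are nested, so each activity goes to a single chosen team.
Every player gets at least the alternative of its own team, which rules out deviations: to an empty
activity by the choice among single activities; to a team from below because growth has stopped; and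
from above because only the parent of the top touches the team there, and the parent had this team
among its options (`Plan.Valid.solution`).

For the running time, `Runs` is a Hoare-style judgement that includes a bound valid when every loop
makes at most `N` rounds. All loops range over players or activities, so `N = n + p` works, and for
a fixed program the bound is a polynomial in `N`. Each piece of the program is shown to carry out
one of the steps above on a memory that represents a plan. The existence statement is a by-product
of the correctness of the program. -/

namespace RAM

/-! ### A program logic with time bounds -/

/-- The state with scalar variable `x` set to `v`. -/
def State.setVar (s : State) (x v : ℕ) : State :=
  { s with var := Function.update s.var x v }

/-- The state with cell `j` of array `a` set to `v`. -/
def State.setArr (s : State) (a j v : ℕ) : State :=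
  { s with arr := Function.update s.arr a (Function.update (s.arr a) j v) }

@[simp] theorem State.setVar_var (s : State) (x v y : ℕ) :
    (s.setVar x v).var y = if y = x then v else s.var y := by
  simp [State.setVar, Function.update_apply]

@[simp] theorem State.setVar_arr (s : State) (x v : ℕ) : (s.setVar x v).arr = s.arr := rfl

@[simp] theorem State.setArr_var (s : State) (a j v : ℕ) : (s.setArr a j v).var = s.var := rfl

@[simp] theorem State.setArr_arr (s : State) (a j v b k : ℕ) :
    (s.setArr a j v).arr b k = if b = a ∧ k = j then v else s.arr b k := by
  by_cases h : b = a
  · subst h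
    simp [State.setArr, Function.update_apply]
  · simp [State.setArr, h]

/-- The program leaves variable `y` alone. -/
def Prog.keepsVar (y : ℕ) : Prog → Bool
  | .skip => true
  | .assign x _ => decide (x ≠ y)
  | .store _ _ _ => true
  | .seq c d => c.keepsVar y && d.keepsVar y
  | .ite _ c d => c.keepsVar y && d.keepsVar y
  | .while _ c => c.keepsVar y

/-- The program leaves array `a` alone. -/
def Prog.keepsArr (a : ℕ) : Prog → Bool
  | .skip => true
  | .assign _ _ => true
  | .store b _ _ => decide (b ≠ a)
  | .seq c d => c.keepsArr a && d.keepsArr a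
  | .ite _ c d => c.keepsArr a && d.keepsArr a
  | .while _ c => c.keepsArr a

/-- Two states agree on everything that the program leaves alone. -/
structure Frame (c : Prog) (s s' : State) : Prop where
  var : ∀ y, c.keepsVar y = true → s'.var y = s.var y
  arr : ∀ a, c.keepsArr a = true → s'.arr a = s.arr a

theorem Frame.refl (c : Prog) (s : State) : Frame c s s := ⟨fun _ _ => rfl, fun _ _ => rfl⟩

theorem Frame.trans {c : Prog} {s s' s'' : State} (h : Frame c s s') (h' : Frame c s' s'') :
    Frame c s s'' :=
  ⟨fun y hy => (h'.var y hy).trans (h.var y hy), fun a ha => (h'.arr a ha).trans (h.arr a ha)⟩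

theorem Frame.mono {c d : Prog} {s s' : State} (h : Frame c s s')
    (hv : ∀ y, d.keepsVar y = true → c.keepsVar y = true)
    (ha : ∀ a, d.keepsArr a = true → c.keepsArr a = true) : Frame d s s' :=
  ⟨fun y hy => h.var y (hv y hy), fun a h' => h.arr a (ha a h')⟩

/-- Since `keepsVar` and `keepsArr` are computed from the syntax, frame conditions of concrete
programs are later discharged by `rfl`. -/
theorem Exec.frame {O : Oracle} {c : Prog} {s s' : State} {t : ℕ} (h : Exec O c s t s') :
    Frame c s s' := by
  induction h with
  | skip s => exact Frame.refl _ _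
  | assign s x e =>
    refine ⟨fun y hy => ?_, fun _ _ => rfl⟩
    have : x ≠ y := by simpa [Prog.keepsVar] using hy
    exact Function.update_of_ne this.symm _ _
  | store s a idx e =>
    refine ⟨fun _ _ => rfl, fun b hb => ?_⟩
    have : a ≠ b := by simpa [Prog.keepsArr] using hb
    exact Function.update_of_ne this.symm _ _
  | seq c d s s' s'' t u _ _ ih ih' =>
    exact (ih.mono (by simp +contextual [Prog.keepsVar]) (by simp +contextual [Prog.keepsArr])).trans
      (ih'.mono (by simp +contextual [Prog.keepsVar]) (by simp +contextual [Prog.keepsArr]))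
  | ite_true e c d s s' t _ _ ih =>
    exact ih.mono (by simp +contextual [Prog.keepsVar]) (by simp +contextual [Prog.keepsArr])
  | ite_false e c d s s' t _ _ ih =>
    exact ih.mono (by simp +contextual [Prog.keepsVar]) (by simp +contextual [Prog.keepsArr])
  | while_true e c s s' s'' t u _ _ _ ih ih' =>
    exact (ih.mono (by simp [Prog.keepsVar]) (by simp [Prog.keepsArr])).trans ih'
  | while_false e c s _ => exact Frame.refl _ _

/-- A bound on the running time of the program if each of its loops makes at most `N` rounds. -/
def Prog.bound (N : ℕ) : Prog → ℕ
  | .skip => 1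
  | .assign _ e => e.time + 1
  | .store _ idx e => idx.time + e.time + 1
  | .seq c d => c.bound N + d.bound N
  | .ite e c d => e.time + (c.bound N + d.bound N) + 1
  | .while e c => N * (e.time + c.bound N + 1) + (e.time + 1)

/-- The degree is governed by the nesting depth of loops, which the program text fixes. -/
theorem Prog.exists_polynomial_bound (c : Prog) :
    ∃ q : Polynomial ℕ, ∀ N, c.bound N = q.eval N := by
  induction c with
  | skip => exact ⟨1, fun N => by simp [Prog.bound]⟩
  | assign x e => exact ⟨Polynomial.C (e.time + 1), fun N => by rw [Polynomial.eval_C]; rfl⟩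
  | store a i e =>
    exact ⟨Polynomial.C (i.time + e.time + 1), fun N => by rw [Polynomial.eval_C]; rfl⟩
  | seq c d ih ih' =>
    obtain ⟨q, hq⟩ := ih
    obtain ⟨r, hr⟩ := ih'
    exact ⟨q + r, fun N => by rw [Polynomial.eval_add, ← hq, ← hr]; rfl⟩
  | ite e c d ih ih' =>
    obtain ⟨q, hq⟩ := ih
    obtain ⟨r, hr⟩ := ih'
    exact ⟨Polynomial.C e.time + (q + r) + 1, fun N => by simp [Prog.bound, hq, hr]⟩
  | _ e c ih =>
    obtain ⟨q, hq⟩ := ih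
    exact ⟨Polynomial.X * (Polynomial.C e.time + q + 1) + (Polynomial.C e.time + 1),
      fun N => by simp [Prog.bound, hq]⟩

/-- Started in `s`, the program halts within its time bound in a state that satisfies `Q`. -/
def Runs (O : Oracle) (N : ℕ) (c : Prog) (s : State) (Q : State → Prop) : Prop :=
  ∃ t s', Exec O c s t s' ∧ t ≤ c.bound N ∧ Q s'

variable {O : Oracle} {N : ℕ}

theorem Runs.imp {c : Prog} {s : State} {Q R : State → Prop} (h : Runs O N c s Q)
    (h' : ∀ s', Frame c s s' → Q s' → R s') : Runs O N c s R := by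
  obtain ⟨t, s', he, ht, hq⟩ := h
  exact ⟨t, s', he, ht, h' s' he.frame hq⟩

theorem Runs.skip {s : State} {Q : State → Prop} (h : Q s) : Runs O N .skip s Q :=
  ⟨_, _, .skip s, le_rfl, h⟩

theorem Runs.assign {s : State} {x : ℕ} {e : Expr} {Q : State → Prop}
    (h : Q (s.setVar x (e.eval O s))) : Runs O N (.assign x e) s Q :=
  ⟨_, _, .assign s x e, le_rfl, h⟩

theorem Runs.store {s : State} {a : ℕ} {i e : Expr} {Q : State → Prop}
    (h : Q (s.setArr a (i.eval O s) (e.eval O s))) : Runs O N (.store a i e) s Q :=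
  ⟨_, _, .store s a i e, le_rfl, h⟩

theorem Runs.seq {c d : Prog} {s : State} {Q R : State → Prop} (h : Runs O N c s Q)
    (h' : ∀ s', Frame c s s' → Q s' → Runs O N d s' R) : Runs O N (.seq c d) s R := by
  obtain ⟨t, s', he, ht, hq⟩ := h
  obtain ⟨u, s'', he', hu, hr⟩ := h' s' he.frame hq
  exact ⟨t + u, s'', .seq _ _ _ _ _ _ _ he he', Nat.add_le_add ht hu, hr⟩

theorem Runs.assign_seq {d : Prog} {s : State} {x : ℕ} {e : Expr} {R : State → Prop}
    (h : Runs O N d (s.setVar x (e.eval O s)) R) : Runs O N (.seq (.assign x e) d) s R :=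
  Runs.seq (Q := fun s' => s' = s.setVar x (e.eval O s)) (Runs.assign rfl)
    fun _ _ hs' => hs' ▸ h

theorem Runs.store_seq {d : Prog} {s : State} {a : ℕ} {i e : Expr} {R : State → Prop}
    (h : Runs O N d (s.setArr a (i.eval O s) (e.eval O s)) R) :
    Runs O N (.seq (.store a i e) d) s R :=
  Runs.seq (Q := fun s' => s' = s.setArr a (i.eval O s) (e.eval O s)) (Runs.store rfl)
    fun _ _ hs' => hs' ▸ h

theorem Runs.ite {e : Expr} {c d : Prog} {s : State} {Q : State → Prop}
    (h : e.eval O s ≠ 0 → Runs O N c s Q) (h' : e.eval O s = 0 → Runs O N d s Q) :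
    Runs O N (.ite e c d) s Q := by
  by_cases he : e.eval O s = 0
  · obtain ⟨t, s', hx, ht, hq⟩ := h' he
    exact ⟨_, s', .ite_false e c d s s' t he hx, by simp only [Prog.bound]; omega, hq⟩
  · obtain ⟨t, s', hx, ht, hq⟩ := h he
    exact ⟨_, s', .ite_true e c d s s' t he hx, by simp only [Prog.bound]; omega, hq⟩

/-- The invariant counts rounds, and termination is part of its preservation: the guard can hold
only while fewer than `K` rounds have passed. -/
theorem Runs.while {e : Expr} {c : Prog} {s : State} (J : ℕ → State → Prop) (K : ℕ) (hK : K ≤ N)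
    (h0 : J 0 s)
    (hJ : ∀ k s', J k s' → Frame c s s' → e.eval O s' ≠ 0 → k < K ∧ Runs O N c s' (J (k + 1))) :
    Runs O N (.while e c) s (fun s' => e.eval O s' = 0 ∧ ∃ k ≤ K, J k s') := by
  have key : ∀ m k s', k + m = K → J k s' → Frame c s s' →
      ∃ t s'', Exec O (.while e c) s' t s'' ∧
        t ≤ m * (e.time + c.bound N + 1) + (e.time + 1) ∧
        (e.eval O s'' = 0 ∧ ∃ k ≤ K, J k s'') := by
    intro m
    induction m with
    | zero =>
      intro k s' hk hj hf
      by_cases he : e.eval O s' = 0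
      · exact ⟨_, s', .while_false e c s' he, by omega, he, k, by omega, hj⟩
      · have := (hJ k s' hj hf he).1
        omega
    | succ m ih =>
      intro k s' hk hj hf
      by_cases he : e.eval O s' = 0
      · exact ⟨_, s', .while_false e c s' he, by omega, he, k, by omega, hj⟩
      · obtain ⟨t, s1, hx, ht, hj1⟩ := (hJ k s' hj hf he).2
        obtain ⟨u, s2, hx', hu, hq⟩ := ih (k + 1) s1 (by omega) hj1 (hf.trans hx.frame)
        refine ⟨_, s2, .while_true e c s' s1 s2 t u he hx hx', ?_, hq⟩
        rw [Nat.succ_mul]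
        omega
  obtain ⟨t, s', hx, ht, hq⟩ := key K 0 s (by omega) h0 (Frame.refl _ _)
  refine ⟨t, s', hx, ht.trans ?_, hq⟩
  simp only [Prog.bound]
  gcongr

/-- `for x = 0, …, b - 1 do c`, where `b` is a variable. -/
def Prog.for (x b : ℕ) (c : Prog) : Prog :=
  .seq (.assign x (.const 0))
    (.while (.le (.add (.var x) (.const 1)) (.var b))
      (.seq c (.assign x (.add (.var x) (.const 1)))))

/-- The body changes neither counter nor bound, so exactly `s.var b` rounds are made. The frame
handed to `hJ` relates the current state to the one before the loop, so loop-independent facts need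
not enter the invariant. -/
theorem Runs.for {x b : ℕ} {c : Prog} {s : State} (J : ℕ → State → Prop) (hb : s.var b ≤ N)
    (hcx : c.keepsVar x = true) (hcb : (Prog.for x b c).keepsVar b = true)
    (h0 : J 0 (s.setVar x 0))
    (hJ : ∀ k s', k < s.var b → s'.var x = k → Frame (Prog.for x b c) s s' → J k s' →
      Runs O N c s' (fun s'' => J (k + 1) (s''.setVar x (k + 1)))) :
    Runs O N (Prog.for x b c) s (fun s' => J (s.var b) s') := by
  have hbx : b ≠ x := by
    simp only [Prog.for, Prog.keepsVar, Bool.and_eq_true, decide_eq_true_eq] at hcb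
    exact hcb.1.symm
  refine Runs.assign_seq ?_
  refine (Runs.while (fun k s' => s'.var x = k ∧ k ≤ s.var b ∧ J k s') (s.var b) hb
    ⟨by simp [Expr.eval], by simp, by simpa [Expr.eval] using h0⟩ ?_).imp ?_
  · rintro k s' ⟨hx, hk, hj⟩ hf he
    have hfb : s'.var b = s.var b := by
      have := hf.var b (by
        simp only [Prog.for, Prog.keepsVar, Bool.and_eq_true] at hcb ⊢
        exact hcb.2)
      rw [this]; simp [hbx]
    have hlt : k < s.var b := by
      simp only [Expr.eval, hx, hfb] at he
      by_contra hc
      exact he (if_neg (by omega))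
    refine ⟨hlt, Runs.seq (hJ k s' hlt hx ?_ hj) ?_⟩
    · have : Frame (Prog.for x b c) s (s.setVar x (Expr.eval O s (.const 0))) := by
        refine ⟨fun y hy => ?_, fun _ _ => rfl⟩
        simp only [Prog.for, Prog.keepsVar, Bool.and_eq_true, decide_eq_true_eq] at hy
        simp [hy.1.symm]
      refine this.trans (hf.mono ?_ ?_) <;> simp +contextual [Prog.for, Prog.keepsVar, Prog.keepsArr]
    · intro s1 hf1 hj1
      have h1 : s1.var x = k := (hf1.var x hcx).trans hx
      refine Runs.assign ?_
      simp only [Expr.eval, h1]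
      exact ⟨by simp, hlt, hj1⟩
  · rintro s' hf ⟨he, k, hk, hx, hk', hj⟩
    have hfb : s'.var b = s.var b := by
      have := hf.var b (by
        simp only [Prog.for, Prog.keepsVar, Bool.and_eq_true] at hcb ⊢
        exact hcb.2)
      rw [this]; simp [hbx]
    have : k = s.var b := by
      simp only [Expr.eval, hx, hfb] at he
      by_contra hc
      rw [if_pos (by omega)] at he
      exact one_ne_zero he
    exact this ▸ hj

/-! ### Tests with bounded quantifiers -/

/-- Formulas over expressions with negation, conjunction and bounded existential quantifiers.
The variable bound by `ex b φ` is numbered by the level at which the formula is read; it ranges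
over the numbers below variable `b`. -/
inductive Test where
  | expr (e : Expr)
  | not (φ : Test)
  | and (φ ψ : Test)
  | ex (b : ℕ) (φ : Test)

/-- The truth value of a formula at level `w`. -/
def Test.Holds (O : Oracle) : Test → ℕ → State → Prop
  | .expr e, _, s => e.eval O s ≠ 0
  | .not φ, w, s => ¬ φ.Holds O w s
  | .and φ ψ, w, s => φ.Holds O w s ∧ ψ.Holds O w s
  | .ex b φ, w, s => ∃ k < s.var b, φ.Holds O (w + 1) (s.setVar w k)

/-- A program that searches for the least `k` below variable `b` such that the test `c`, which
reads `k` in variable `w` and writes its result to variable `w + 1`, succeeds. It leaves `k + 1`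
or `0` in variable `w`. -/
def Prog.search (w b : ℕ) (c : Prog) : Prog :=
  .seq (.assign w (.const 0)) (.seq (.assign (w + 1) (.const 0))
    (.seq (.while (.sub (.le (.add (.var w) (.const 1)) (.var b)) (.var (w + 1)))
        (.seq c (.assign w (.add (.var w) (.const 1)))))
      (.ite (.var (w + 1)) .skip (.assign w (.const 0)))))

/-- A program that evaluates a formula at level `w`, using only variables from `w` on, and leaves
the result in variable `w`. -/
def Test.prog : Test → ℕ → Prog
  | .expr e, w => .assign w e
  | .not φ, w => .seq (φ.prog w) (.assign w (.eq (.var w) (.const 0)))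
  | .and φ ψ, w => .seq (φ.prog w) (.ite (.var w) (ψ.prog w) .skip)
  | .ex b φ, w => .search w b (φ.prog (w + 1))

/-- The expression uses only variables below `w`. -/
def Expr.scoped (w : ℕ) : Expr → Bool
  | .const _ => true
  | .var x => decide (x < w)
  | .get _ e => e.scoped w
  | .add e f => e.scoped w && f.scoped w
  | .sub e f => e.scoped w && f.scoped w
  | .le e f => e.scoped w && f.scoped w
  | .eq e f => e.scoped w && f.scoped w
  | .pref i a k b l => i.scoped w && (a.scoped w && (k.scoped w && (b.scoped w && l.scoped w)))
  | .adj i j => i.scoped w && j.scoped w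

/-- The formula at level `w` uses only variables below `w` besides bound ones, and its
quantifiers are bounded by variables `0` and `1`. -/
def Test.scoped : Test → ℕ → Bool
  | .expr e, w => e.scoped w
  | .not φ, w => φ.scoped w
  | .and φ ψ, w => φ.scoped w && ψ.scoped w
  | .ex b φ, w => decide (b < 2) && φ.scoped (w + 1)

/-- Equality of all arrays and of the variables below `w`. -/
structure AgreeBelow (w : ℕ) (s s' : State) : Prop where
  arr : s'.arr = s.arr
  var : ∀ y < w, s'.var y = s.var y

theorem AgreeBelow.setVar {w : ℕ} {s s' : State} (h : AgreeBelow w s s') (k : ℕ) :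
    AgreeBelow (w + 1) (s.setVar w k) (s'.setVar w k) :=
  ⟨h.arr, fun y hy => by
    by_cases hyw : y = w
    · simp [hyw]
    · simpa [hyw] using h.var y (by omega)⟩

theorem Expr.eval_congr {w : ℕ} {s s' : State} (h : AgreeBelow w s s') (e : Expr)
    (he : e.scoped w = true) : e.eval O s' = e.eval O s := by
  induction e with
  | const c => rfl
  | var x => exact h.var x (by simpa [Expr.scoped] using he)
  | get a e ih => simp only [Expr.eval, ih he, h.arr]
  | add e f ih ih' | sub e f ih ih' | le e f ih ih' | eq e f ih ih' | adj e f ih ih' =>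
    simp only [Expr.scoped, Bool.and_eq_true] at he
    simp only [Expr.eval]
    rw [ih he.1, ih' he.2]
  | pref i a k b l h1 h2 h3 h4 h5 =>
    simp only [Expr.scoped, Bool.and_eq_true] at he
    obtain ⟨e1, e2, e3, e4, e5⟩ := he
    simp only [Expr.eval]
    rw [h1 e1, h2 e2, h3 e3, h4 e4, h5 e5]

/-- The condition `2 ≤ w` protects variables `0` and `1`, which bound the quantifiers. -/
theorem Test.holds_congr {w : ℕ} {s s' : State} (φ : Test) (h : AgreeBelow w s s') (hw : 2 ≤ w)
    (hφ : φ.scoped w = true) : φ.Holds O w s' ↔ φ.Holds O w s := by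
  induction φ generalizing w s s' with
  | expr e => simp only [Test.Holds, Expr.eval_congr h e hφ]
  | not φ ih => simp only [Test.Holds, ih h hw hφ]
  | and φ ψ ih ih' =>
    simp only [Test.scoped, Bool.and_eq_true] at hφ
    simp only [Test.Holds, ih h hw hφ.1, ih' h hw hφ.2]
  | ex b φ ih =>
    simp only [Test.scoped, Bool.and_eq_true, decide_eq_true_eq] at hφ
    simp only [Test.Holds, h.var b (by omega), ih (h.setVar _) (by omega) hφ.2]

theorem AgreeBelow.trans {w : ℕ} {s s' s'' : State} (h : AgreeBelow w s s')
    (h' : AgreeBelow w s' s'') : AgreeBelow w s s'' :=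
  ⟨h'.arr.trans h.arr, fun y hy => (h'.var y hy).trans (h.var y hy)⟩

theorem AgreeBelow.mono {w w' : ℕ} {s s' : State} (h : AgreeBelow w s s') (hw : w' ≤ w) :
    AgreeBelow w' s s' :=
  ⟨h.arr, fun y hy => h.var y (by omega)⟩

theorem AgreeBelow.setVar_right {w x k : ℕ} {s s' : State} (h : AgreeBelow w s s') (hx : w ≤ x) :
    AgreeBelow w s (s'.setVar x k) :=
  ⟨h.arr, fun y hy => by simpa [show y ≠ x by omega] using h.var y hy⟩

theorem AgreeBelow.refl (w : ℕ) (s : State) : AgreeBelow w s s := ⟨rfl, fun _ _ => rfl⟩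

/-- The counter is advanced even after a success, so the loop stops with `k + 1` in variable `w`;
this keeps `0` free to report failure. -/
theorem Runs.search {w b : ℕ} {c : Prog} {s : State} (P : ℕ → Prop) (hbw : b < w)
    (hb : s.var b ≤ N)
    (hc : ∀ k s', k < s.var b → AgreeBelow (w + 1) (s.setVar w k) s' →
      Runs O N c s' (fun s'' => AgreeBelow (w + 1) s' s'' ∧ (s''.var (w + 1) ≠ 0 ↔ P k))) :
    Runs O N (Prog.search w b c) s (fun s' => AgreeBelow w s s' ∧
      ((s'.var w = 0 ∧ ∀ k < s.var b, ¬ P k) ∨ ∃ k < s.var b, P k ∧ s'.var w = k + 1)) := by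
  refine Runs.assign_seq (Runs.assign_seq (Runs.seq (Runs.while
    (fun k s' => AgreeBelow w s s' ∧ s'.var w = k ∧ k ≤ s.var b ∧
      ((s'.var (w + 1) = 0 ∧ ∀ j < k, ¬ P j) ∨
        (s'.var (w + 1) ≠ 0 ∧ ∃ j < s.var b, P j ∧ k = j + 1))) (s.var b) hb ?_ ?_) ?_))
  · exact ⟨((AgreeBelow.refl w s).setVar_right le_rfl).setVar_right (by omega), by
      simp [Expr.eval], by omega, Or.inl (by simp [Expr.eval])⟩
  · rintro k s' ⟨hag, hk, hkb, hor⟩ - he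
    simp only [Expr.eval, hk, hag.var b hbw] at he
    have hlt : k < s.var b := by
      by_contra hcon
      rw [if_neg (by omega)] at he
      simp at he
    -- A nonzero success flag would make the truncated subtraction in the guard vanish.
    have hnone : s'.var (w + 1) = 0 ∧ ∀ j < k, ¬ P j := by
      refine hor.resolve_right fun h => he ?_
      have := h.1
      rw [if_pos (by omega)]
      omega
    refine ⟨hlt, Runs.seq (hc k s' hlt ⟨hag.arr, fun y hy => ?_⟩) ?_⟩
    · by_cases hyw : y = w
      · simp [hyw, hk]
      · simpa [hyw] using hag.var y (by omega)
    · rintro s1 - ⟨h1, hP⟩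
      refine Runs.assign ⟨(hag.trans (h1.mono (by omega))).setVar_right le_rfl, ?_, hlt, ?_⟩
      · simp [Expr.eval, h1.var w (by omega), hk]
      · by_cases hz : P k
        · exact Or.inr ⟨by simpa using hP.2 hz, k, hlt, hz, rfl⟩
        · refine Or.inl ⟨by simpa using mt hP.1 hz, fun j hj => ?_⟩
          rcases Nat.lt_succ_iff_lt_or_eq.1 hj with h | h
          · exact hnone.2 j h
          · exact h ▸ hz
  · rintro s' - ⟨he, k, hk, hag, hw, hkb, hor⟩
    refine Runs.ite (fun h => Runs.skip ?_) (fun h => Runs.assign ?_)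
    · rcases hor with h' | ⟨-, j, hj, hP, hkj⟩
      · exact absurd h'.1 h
      · exact ⟨hag, Or.inr ⟨j, hj, hP, hw.trans hkj⟩⟩
    · refine ⟨hag.setVar_right le_rfl, Or.inl ⟨by simp [Expr.eval], ?_⟩⟩
      rcases hor with h' | h'
      · have : s.var b ≤ k := by
          by_contra hcon
          simp only [Expr.eval, hw, hag.var b hbw, h'.1] at he
          rw [if_pos (by omega)] at he
          simp at he
        exact fun j hj => h'.2 j (by omega)
      · exact absurd h h'.1

/-- Bound variables and intermediate results live on a stack that starts at `w`. A subformula is run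
one level higher, where it spares the variable bound outside it, and scoping makes its value
independent of leftovers on the stack. -/
theorem Runs.test {s : State} (φ : Test) (w : ℕ) (hw : 2 ≤ w) (hN : ∀ b < 2, s.var b ≤ N)
    (hφ : φ.scoped w = true) :
    Runs O N (φ.prog w) s (fun s' => AgreeBelow w s s' ∧ (s'.var w ≠ 0 ↔ φ.Holds O w s)) := by
  induction φ generalizing w s with
  | expr e =>
    exact Runs.assign ⟨(AgreeBelow.refl w s).setVar_right le_rfl, by simp [Test.Holds]⟩
  | not φ ih =>
    refine Runs.seq (ih w hw hN hφ) fun s' _ h => Runs.assign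
      ⟨h.1.setVar_right le_rfl, ?_⟩
    simp only [Test.Holds, ← h.2]
    by_cases h0 : s'.var w = 0 <;> simp [Expr.eval, h0]
  | and φ ψ ih ih' =>
    simp only [Test.scoped, Bool.and_eq_true] at hφ
    refine Runs.seq (ih w hw hN hφ.1) fun s' _ h => Runs.ite (fun h0 => ?_) (fun h0 => ?_)
    · refine (ih' w hw (fun b hb => ?_) hφ.2).imp fun s'' _ h' => ⟨h.1.trans h'.1, ?_⟩
      · rw [h.1.var b (by omega)]
        exact hN b hb
      · rw [h'.2, Test.holds_congr ψ h.1 hw hφ.2]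
        simp only [Test.Holds]
        have := h.2.1 h0
        tauto
    · refine Runs.skip ⟨h.1, ?_⟩
      have : ¬ φ.Holds O w s := fun hh => h.2.2 hh h0
      simp only [Test.Holds]
      simp only [Expr.eval] at h0
      tauto
  | ex b φ ih =>
    simp only [Test.scoped, Bool.and_eq_true, decide_eq_true_eq] at hφ
    refine (Runs.search (fun k => φ.Holds O (w + 1) (s.setVar w k)) (by omega) (hN b hφ.1)
      fun k s' hk hs' => ?_).imp fun s' _ h => ⟨h.1, ?_⟩
    · refine (ih (w + 1) (by omega) (fun b' hb' => ?_) hφ.2).imp fun s'' _ h => ⟨h.1, ?_⟩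
      · rw [hs'.var b' (by omega)]
        simpa [show b' ≠ w by omega] using hN b' hb'
      · rw [h.2, Test.holds_congr φ hs' (by omega) hφ.2]
    · simp only [Test.Holds]
      rcases h.2 with ⟨h0, h1⟩ | ⟨k, hk, hP, h0⟩
      · simpa [h0] using h1
      · simp only [h0]
        exact ⟨fun _ => ⟨k, hk, hP⟩, fun _ => by simp⟩

/-- The search for a value that satisfies a formula. -/
theorem Runs.find {s : State} (b : ℕ) (φ : Test) (w : ℕ) (hw : 2 ≤ w)
    (hN : ∀ b < 2, s.var b ≤ N) (hφ : (Test.ex b φ).scoped w = true) :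
    Runs O N ((Test.ex b φ).prog w) s (fun s' => AgreeBelow w s s' ∧
      ((s'.var w = 0 ∧ ∀ k < s.var b, ¬ φ.Holds O (w + 1) (s.setVar w k)) ∨
        ∃ k < s.var b, φ.Holds O (w + 1) (s.setVar w k) ∧ s'.var w = k + 1)) := by
  simp only [Test.scoped, Bool.and_eq_true, decide_eq_true_eq] at hφ
  refine Runs.search (fun k => φ.Holds O (w + 1) (s.setVar w k)) (by omega) (hN b hφ.1)
    fun k s' hk hs' => ?_
  refine (Runs.test φ (w + 1) (by omega) (fun b' hb' => ?_) hφ.2).imp fun s'' _ h => ⟨h.1, ?_⟩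
  · rw [hs'.var b' (by omega)]
    simpa [show b' ≠ w by omega] using hN b' hb'
  · rw [h.2, Test.holds_congr φ hs' (by omega) hφ.2]

end RAM

/-! ### Leaves of forests -/

namespace SimpleGraph

/-- In an acyclic graph, every nonempty finite set of vertices has a member with at most one
neighbour in the set. -/
theorem IsAcyclic.exists_subsingleton_neighbors {V : Type*} [Finite V] {G : SimpleGraph V}
    (hG : G.IsAcyclic) {U : Set V} (hU : U.Nonempty) :
    ∃ i ∈ U, ∀ j ∈ U, ∀ k ∈ U, G.Adj i j → G.Adj i k → j = k := by
  have : Nonempty U := hU.to_subtype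
  obtain ⟨u, v, q, hq, hmax⟩ := Walk.exists_isPath_forall_isPath_length_le_length (G.induce U)
  -- A longest path cannot be prolonged, so every neighbour of its end `v` lies on it; without
  -- cycles only the penultimate vertex remains.
  have key : ∀ w, (G.induce U).Adj v w → w = q.penultimate := fun w hadj => by
    apply (hG.induce U).eq_penultimate_of_adj_end hq hadj
    have : ¬(q.concat hadj).IsPath := by grind [Walk.length_concat]
    grind [Walk.IsPath.concat]
  exact ⟨v, v.2, fun j hj k hk h h' =>
    congrArg Subtype.val ((key ⟨j, hj⟩ h).trans (key ⟨k, hk⟩ h').symm)⟩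

end SimpleGraph

/-! ### Plans, their invariants, and the stability of the final assignment -/

namespace GGASP

variable {n p : ℕ}

theorem void_mem_alternatives : (none, 1) ∈ alternatives n p := Or.inr rfl

theorem some_mem_alternatives {a : Fin p} {k : ℕ} :
    (some a, k) ∈ alternatives n p ↔ 1 ≤ k ∧ k ≤ n := by
  simp [alternatives]

theorem weakPref_refl (I : GGASP n p) (i : Fin n) {x : Option (Fin p) × ℕ}
    (hx : x ∈ alternatives n p) : I.weakPref i x x :=
  or_self_iff.1 (I.complete i x hx x hx)

/-- Intermediate data of the algorithm. Players are labelled in the order in which they are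
processed, with decreasing positive labels; label `0` means that the player is still to be
processed. With every processed player the plan associates a team with an activity. -/
structure Plan (n p : ℕ) where
  label : Fin n → ℕ
  act : Fin n → Option (Fin p)
  team : Fin n → Finset (Fin n)

namespace Plan

/-- The alternative that the team of player `i` gets. -/
def alt (T : Plan n p) (i : Fin n) : Option (Fin p) × ℕ := (T.act i, (T.team i).card)

/-- All members of the team of `i` accept a further member. -/
def Accepts (I : GGASP n p) (T : Plan n p) (i : Fin n) : Prop :=
  ∀ j ∈ T.team i, I.weakPref j (T.act i, (T.team i).card + 1) (T.act i, (T.team i).card)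

/-- The activity is that of the team of a processed player. -/
def Used (T : Plan n p) (b : Fin p) : Prop := ∃ j, T.label j ≠ 0 ∧ T.act j = some b

/-- `x` players are processed, with labels `n, …, n - x + 1`, and every processed player has at
most one neighbour with smaller label. -/
structure Layout (I : GGASP n p) (T : Plan n p) (x : ℕ) : Prop where
  range : ∀ i, T.label i ≠ 0 → n - x < T.label i ∧ T.label i ≤ n
  inj : ∀ i j, T.label i ≠ 0 → T.label i = T.label j → i = j
  card : (Finset.univ.filter fun i => T.label i ≠ 0).card = x
  upper : ∀ i j k, T.label i ≠ 0 → I.network.Adj i j → I.network.Adj i k →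
    T.label j < T.label i → T.label k < T.label i → j = k

/-- The team of `i` is connected with top `i`, its members like it at least as much as their own
teams, and `i` likes it at least as much as being alone or joining the team of a neighbour below. -/
structure Sound (I : GGASP n p) (T : Plan n p) (i : Fin n) : Prop where
  self : i ∈ T.team i
  low : ∀ k ∈ T.team i, T.label i ≤ T.label k
  up : ∀ k ∈ T.team i, k ≠ i → ∃ j ∈ T.team i, I.network.Adj k j ∧ T.label j < T.label k
  void : T.act i = none → T.team i = {i}
  gain : ∀ j ∈ T.team i, I.weakPref j (T.alt i) (T.alt j)
  rational : I.weakPref i (T.alt i) (none, 1)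
  single : ∀ b, I.weakPref i (T.alt i) (some b, 1)
  child : ∀ c, I.network.Adj i c → T.label i < T.label c → T.act c ≠ none → T.Accepts I c →
    I.weakPref i (T.alt i) (T.act c, (T.team c).card + 1)

/-- No player below the team of `i` wants to join it and is accepted. -/
def Closed (I : GGASP n p) (T : Plan n p) (i : Fin n) : Prop :=
  T.act i ≠ none → T.Accepts I i → ∀ m ∈ T.team i, ∀ k ∉ T.team i, I.network.Adj k m →
    T.label m < T.label k → ¬ I.StrictPref k (T.act i, (T.team i).card + 1) (T.alt k)

/-- The invariant of the algorithm when `x` players have been processed. -/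
structure Valid (I : GGASP n p) (T : Plan n p) (x : ℕ) : Prop extends Layout I T x where
  sound : ∀ i, T.label i ≠ 0 → T.Sound I i
  closed : ∀ i, T.label i ≠ 0 → T.Closed I i
  nested : ∀ i j, T.label i ≠ 0 → T.label j ≠ 0 → T.act i ≠ none → T.act i = T.act j →
    T.team i ⊆ T.team j ∨ T.team j ⊆ T.team i

variable {I : GGASP n p} {T : Plan n p}

/-- Transitivity and completeness are available for genuine alternatives only. The void activity is
one only at size `1`, which is why void teams must be singletons. -/
theorem Sound.alt_mem {i : Fin n} (h : T.Sound I i) : T.alt i ∈ alternatives n p := by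
  unfold alt
  cases ha : T.act i with
  | none => rw [h.void ha]; exact void_mem_alternatives
  | some a =>
    exact some_mem_alternatives.2 ⟨Finset.card_pos.2 ⟨i, h.self⟩,
      (Finset.card_le_univ _).trans (by simp)⟩

/-- A player outside the team witnesses that the enlarged size is still at most `n`. -/
theorem joined_mem {i k : Fin n} (h : k ∉ T.team i) (ha : T.act i ≠ none) :
    (T.act i, (T.team i).card + 1) ∈ alternatives n p := by
  obtain ⟨a, ha⟩ := Option.ne_none_iff_exists'.1 ha
  rw [ha, some_mem_alternatives]
  refine ⟨by omega, ?_⟩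
  rw [← Finset.card_insert_of_notMem h]
  exact (Finset.card_le_univ _).trans (by simp)

/-- Stepping to neighbours of smaller label inside the team can only end at the top. -/
theorem Sound.preconnected {i : Fin n} (h : T.Sound I i) : I.FeasibleCoalition (T.team i) := by
  have key : ∀ l k (hk : k ∈ T.team i), T.label k = l →
      (I.network.induce (T.team i : Set (Fin n))).Reachable ⟨k, hk⟩ ⟨i, h.self⟩ := by
    intro l
    induction l using Nat.strong_induction_on with
    | _ l ih =>
      intro k hk hl
      by_cases hki : k = i
      · subst hki
        exact .refl _
      · obtain ⟨j, hj, hadj, hlt⟩ := h.up k hk hki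
        refine .trans (SimpleGraph.Adj.reachable ?_) (ih _ (hl ▸ hlt) j hj rfl)
        exact hadj
  intro a b
  exact (key _ a.1 a.2 rfl).trans (key _ b.1 b.2 rfl).symm

theorem exists_adj_of_feasible {S : Finset (Fin n)} {i t : Fin n} (hi : i ∉ S) (ht : t ∈ S)
    (h : I.FeasibleCoalition (insert i S)) : ∃ m ∈ S, I.network.Adj i m := by
  obtain ⟨w⟩ := h ⟨i, by simp⟩ ⟨t, by simp [ht]⟩
  cases w with
  | nil => exact absurd ht hi
  | @cons _ v _ hadj _ =>
    have hadj' : I.network.Adj i v.1 := hadj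
    refine ⟨v.1, ?_, hadj'⟩
    have hv := v.2
    simp only [Finset.coe_insert, Set.mem_insert_iff, Finset.mem_coe] at hv
    exact hv.resolve_left fun e => hadj'.ne e.symm

/-- A valid plan and a partition of the players into teams give a solution. -/
theorem Valid.solution (hT : T.Valid I n) (top : Fin n → Fin n)
    (hmem : ∀ i, i ∈ T.team (top i)) (htop : ∀ i, ∀ k ∈ T.team (top i), top k = top i) :
    I.FeasibleAssignment (fun i => T.act (top i)) ∧
      I.IndividuallyStable (fun i => T.act (top i)) := by
  set π : Fin n → Option (Fin p) := fun i => T.act (top i) with hπ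
  have hdone : ∀ i, T.label i ≠ 0 := by
    have := Finset.filter_card_eq (s := Finset.univ) (p := fun i => T.label i ≠ 0)
      (hT.card.trans (by simp))
    exact fun i => this i (Finset.mem_univ i)
  have hsound := fun i => hT.sound i (hdone i)
  have htt : ∀ i, top (top i) = top i := fun i => htop i _ (hsound _).self
  have hsame : ∀ i j, T.act (top i) ≠ none → T.act (top i) = T.act (top j) → top i = top j := by
    intro i j h0 h
    rcases hT.nested _ _ (hdone _) (hdone _) h0 h with h' | h'
    · rw [← htt i]
      exact htop j _ (h' (hsound _).self)
    · rw [← htt j]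
      exact (htop i _ (h' (hsound _).self)).symm
  have hteam : ∀ i j, j ∈ T.team (top i) ↔ top j = top i :=
    fun i j => ⟨htop i j, fun h => h ▸ hmem j⟩
  have hcoal : ∀ i, coalition π i = T.team (top i) := by
    intro i
    unfold coalition
    split_ifs with h
    -- A void team consists of its top alone, so `i` is its own top.
    · have h1 := (hsound _).void h
      have h2 := hmem i
      rw [h1, Finset.mem_singleton] at h2
      rw [h1, ← h2]
    · ext j
      simp only [Finset.mem_filter, Finset.mem_univ, true_and, hteam]
      exact ⟨fun e => (hsame i j h e.symm).symm, fun e => by simp only [hπ, e]⟩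
  have hgain : ∀ i, I.weakPref i (outcome π i) (T.alt i) := by
    intro i
    have := (hsound (top i)).gain i (hmem i)
    simpa [outcome, hcoal, alt] using this
  have halt := fun i => (hsound i).alt_mem
  have hout : ∀ i, outcome π i ∈ alternatives n p := by
    intro i
    simpa [outcome, hcoal, alt] using halt (top i)
  refine ⟨fun i => hcoal i ▸ (hsound _).preconnected, fun i _ =>
    I.transitive i _ (hout i) _ (halt i) _ void_mem_alternatives (hgain i) (hsound i).rational, ?_⟩
  rintro i a hfeas ⟨⟨hne, hpref⟩, hacc⟩
  -- The outcome of `i` is at least `T.alt i`, so a deviation must be strictly better than `T.alt i`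
  -- too.
  have hbetter : ∀ y, y ∈ alternatives n p → I.weakPref i (T.alt i) y →
      y = (some a, (group π a).card + 1) → False := by
    rintro y hy h rfl
    exact hpref.2 (I.transitive i _ (hout i) _ (halt i) _ hy (hgain i) h)
  have hn : 1 ≤ n := by have := i.2; omega
  rcases (group π a).eq_empty_or_nonempty with he | ⟨t, ht⟩
  · exact hbetter _ (some_mem_alternatives.2 ⟨le_rfl, hn⟩) ((hsound i).single a) (by simp [he])
  · have hta : T.act (top t) = some a := by simpa [group, hπ] using ht
    have hgroup : group π a = T.team (top t) := by
      ext j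
      simp only [group, Finset.mem_filter, Finset.mem_univ, true_and, hteam]
      refine ⟨fun e => (hsame t j (by simp [hta]) (hta.trans e.symm)).symm, fun e => ?_⟩
      simp only [hπ, e, hta]
    have hi : i ∉ T.team (top t) := by
      rw [← hgroup]
      simpa [group] using hne
    have hact : T.act (top t) ≠ none := by simp [hta]
    have haccept : T.Accepts I (top t) := by
      intro j hj
      have := hacc j (hgroup ▸ hj)
      rwa [hgroup, ← hta] at this
    rw [hgroup] at hfeas
    have hmemj := joined_mem hi hact
    obtain ⟨m, hm, hadj⟩ := exists_adj_of_feasible hi (hsound _).self hfeas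
    have hgen : (some a, (group π a).card + 1) = (T.act (top t), (T.team (top t)).card + 1) := by
      rw [hta, hgroup]
    -- If `m` has the smaller label, `i` approaches the team from below and closedness applies;
    -- otherwise `i` is the parent of `m`.
    rcases lt_trichotomy (T.label m) (T.label i) with hlt | heq | hlt
    · refine hT.closed _ (hdone _) hact haccept m hm i hi hadj hlt ⟨?_, fun h => ?_⟩
      · exact I.transitive i _ hmemj _ (hout i) _ (halt i) (hgen ▸ hpref.1) (hgain i)
      · exact hbetter _ hmemj h hgen.symm
    · exact hadj.ne (hT.inj _ _ (hdone i) heq.symm)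
    -- Any member other than the top has its only neighbour of smaller label inside the team, and
    -- `i` would be that neighbour.
    · have hmt : m = top t := by
        by_contra hmt
        obtain ⟨j, hj, hadj', hlt'⟩ := (hsound _).up m hm hmt
        exact hi (hT.upper m i j (hdone m) hadj.symm hadj' hlt hlt' ▸ hj)
      subst hmt
      exact hbetter _ hmemj ((hsound i).child _ hadj hlt hact haccept) hgen.symm

/-! ### Processing a player -/

/-- The plan with the data of player `i` replaced. -/
def set (T : Plan n p) (i : Fin n) (l : ℕ) (α : Option (Fin p)) (S : Finset (Fin n)) :
    Plan n p where
  label := Function.update T.label i l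
  act := Function.update T.act i α
  team := Function.update T.team i S

section set

variable {i : Fin n} {l : ℕ} {α : Option (Fin p)} {S : Finset (Fin n)}

@[simp] theorem set_label_self : (T.set i l α S).label i = l := by simp [set]
@[simp] theorem set_act_self : (T.set i l α S).act i = α := by simp [set]
@[simp] theorem set_team_self : (T.set i l α S).team i = S := by simp [set]
@[simp] theorem set_alt_self : (T.set i l α S).alt i = (α, S.card) := by simp [alt]

variable {j : Fin n}

theorem set_label (h : j ≠ i) : (T.set i l α S).label j = T.label j := by simp [set, h]
theorem set_act (h : j ≠ i) : (T.set i l α S).act j = T.act j := by simp [set, h]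
theorem set_team (h : j ≠ i) : (T.set i l α S).team j = T.team j := by simp [set, h]
theorem set_alt (h : j ≠ i) : (T.set i l α S).alt j = T.alt j := by
  simp [alt, set_act h, set_team h]
theorem set_accepts (h : j ≠ i) : (T.set i l α S).Accepts I j ↔ T.Accepts I j := by
  simp [Accepts, set_act h, set_team h]

/-- Soundness of `j` involves only players labelled at least as high as `j`, while `i` is strictly
lower both before and after the change. -/
theorem Sound.set (h : T.Sound I j) (hi : T.label i < T.label j) (hl : l < T.label j) :
    (T.set i l α S).Sound I j := by
  have hne : ∀ k, T.label j ≤ T.label k → k ≠ i := by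
    rintro k hk rfl
    omega
  have hji := hne j le_rfl
  have hm := fun k hk => hne k (h.low k hk)
  refine ⟨by simpa [set_team hji] using h.self, ?_, ?_, ?_, ?_, ?_, ?_, ?_⟩
  · intro k hk
    rw [set_team hji] at hk
    simpa [set_label hji, set_label (hm k hk)] using h.low k hk
  · intro k hk hkj
    rw [set_team hji] at hk ⊢
    obtain ⟨m, hm', hadj, hlt⟩ := h.up k hk hkj
    exact ⟨m, hm', hadj, by simpa [set_label (hm k hk), set_label (hm m hm')] using hlt⟩
  · simpa [set_act hji, set_team hji] using h.void
  · intro k hk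
    rw [set_team hji] at hk
    simpa [set_alt hji, set_alt (hm k hk)] using h.gain k hk
  · simpa [set_alt hji] using h.rational
  · simpa [set_alt hji] using h.single
  · intro c hadj hlt ha hacc
    have hc : c ≠ i := by
      rintro rfl
      simp only [set_label_self, set_label hji] at hlt
      omega
    rw [set_label hc, set_label hji] at hlt
    rw [set_act hc] at ha ⊢
    rw [set_accepts hc] at hacc
    simpa [set_alt hji, set_team hc] using h.child c hadj hlt ha hacc

theorem Closed.set (h : T.Closed I j) (hs : T.Sound I j) (hi : T.label i < T.label j)
    (hl : l < T.label j) : (T.set i l α S).Closed I j := by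
  have hne : ∀ k, T.label j ≤ T.label k → k ≠ i := by
    rintro k hk rfl
    omega
  have hji := hne j le_rfl
  intro ha hacc m hm k hk hadj hlt
  rw [set_act hji] at ha ⊢
  rw [set_accepts hji] at hacc
  rw [set_team hji] at hm hk ⊢
  have hmj := hs.low m hm
  have hmi := hne m hmj
  have hki : k ≠ i := by
    rintro rfl
    simp only [set_label_self, set_label hmi] at hlt
    omega
  rw [set_label hmi, set_label hki] at hlt
  rw [set_alt hki]
  exact h ha hacc m hm k hk hadj hlt

end set

/-- By counting, some player is unprocessed, and the leaf lemma applies to the set of these players.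
-/
theorem Layout.exists_next {x : ℕ} (h : T.Layout I x) (hx : x < n) (hI : I.network.IsAcyclic) :
    ∃ i, T.label i = 0 ∧ ∀ j k, I.network.Adj i j → T.label j = 0 → I.network.Adj i k →
      T.label k = 0 → j = k := by
  have hne : {i | T.label i = 0}.Nonempty := by
    by_contra hcon
    rw [Set.not_nonempty_iff_eq_empty, Set.eq_empty_iff_forall_notMem] at hcon
    have := h.card
    rw [Finset.filter_true_of_mem (by simpa using hcon)] at this
    simp at this
    omega
  obtain ⟨i, hi, h'⟩ := hI.exists_subsingleton_neighbors hne
  exact ⟨i, hi, fun j k hj hj0 hk hk0 => h' j hj0 k hk0 hj hk⟩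

/-- The new label is below all labels in use. So the neighbours of `i` with smaller label are its
unprocessed ones, and no older player acquires an additional neighbour of smaller label. -/
theorem Layout.set {x : ℕ} {i : Fin n} {α : Option (Fin p)} {S : Finset (Fin n)}
    (h : T.Layout I x) (hx : x < n) (hi : T.label i = 0)
    (hnext : ∀ j k, I.network.Adj i j → T.label j = 0 → I.network.Adj i k →
      T.label k = 0 → j = k) : (T.set i (n - x) α S).Layout I (x + 1) := by
  have hbig : ∀ j, T.label j ≠ 0 → n - x < T.label j := fun j hj => (h.range j hj).1
  have hlow : ∀ j, (T.set i (n - x) α S).label j < n - x → T.label j = 0 ∧ j ≠ i := by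
    intro j hj
    have hji : j ≠ i := by
      rintro rfl
      simp at hj
    rw [set_label hji] at hj
    refine ⟨?_, hji⟩
    by_contra h0
    have := hbig j h0
    omega
  refine ⟨?_, ?_, ?_, ?_⟩
  · intro j hj
    by_cases hji : j = i
    · subst hji
      simp
      omega
    · rw [set_label hji] at hj ⊢
      have := h.range j hj
      omega
  · intro j k hj hjk
    by_cases hji : j = i <;> by_cases hki : k = i
    · rw [hji, hki]
    · subst hji
      rw [set_label hki, set_label_self] at hjk
      have := hbig k (by omega)
      omega
    · subst hki
      rw [set_label hji] at hj
      rw [set_label hji, set_label_self] at hjk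
      have := hbig j hj
      omega
    · rw [set_label hji] at hj
      rw [set_label hji, set_label hki] at hjk
      exact h.inj j k hj hjk
  · have : (Finset.univ.filter fun j => (T.set i (n - x) α S).label j ≠ 0) =
        insert i (Finset.univ.filter fun j => T.label j ≠ 0) := by
      ext j
      by_cases hji : j = i
      · subst hji
        simp
        omega
      · simp [set_label hji, hji]
    rw [this, Finset.card_insert_of_notMem (by simp [hi]), h.card]
  · intro j k m hj hjk hjm hk hm
    by_cases hji : j = i
    · subst hji
      rw [set_label_self] at hk hm
      exact hnext k m hjk (hlow k hk).1 hjm (hlow m hm).1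
    · rw [set_label hji] at hj hk hm
      have key : ∀ k, (T.set i (n - x) α S).label k < T.label j → T.label k < T.label j := by
        intro k hk
        by_cases hki : k = i
        · subst hki
          omega
        · rwa [set_label hki] at hk
      exact h.upper j k m hj hjk hjm (key k hk) (key m hm)

/-- The state of affairs while the team of player `i` grows. -/
structure Growing (I : GGASP n p) (T : Plan n p) (x : ℕ) (i : Fin n) : Prop
    extends Layout I T x where
  label_pos : T.label i ≠ 0
  label_lt : ∀ j, j ≠ i → T.label j ≠ 0 → T.label i < T.label j
  sound : ∀ j, T.label j ≠ 0 → T.Sound I j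
  closed : ∀ j, j ≠ i → T.label j ≠ 0 → T.Closed I j
  nested : ∀ j k, j ≠ i → k ≠ i → T.label j ≠ 0 → T.label k ≠ 0 → T.act j ≠ none →
    T.act j = T.act k → T.team j ⊆ T.team k ∨ T.team k ⊆ T.team j
  covers : ∀ j, j ≠ i → T.label j ≠ 0 → T.act j ≠ none → T.act j = T.act i →
    T.team j ⊆ T.team i

theorem Growing.valid {x : ℕ} {i : Fin n} (h : T.Growing I x i) (hc : T.Closed I i) :
    T.Valid I x where
  toLayout := h.toLayout
  sound := h.sound
  closed j hj := by
    by_cases hji : j = i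
    · exact hji ▸ hc
    · exact h.closed j hji hj
  nested j k hj hk ha hjk := by
    by_cases hji : j = i <;> by_cases hki : k = i
    · subst hji hki
      exact Or.inl subset_rfl
    · subst hji
      exact Or.inr (h.covers k hki hk (hjk ▸ ha) hjk.symm)
    · subst hki
      exact Or.inl (h.covers j hji hj ha hjk)
    · exact h.nested j k hji hki hj hk ha hjk

/-- A processed player who wants to join the growing team and is accepted. -/
structure Joins (I : GGASP n p) (T : Plan n p) (i k : Fin n) : Prop where
  act : T.act i ≠ none
  done : T.label k ≠ 0
  notMem : k ∉ T.team i
  adj : ∃ m ∈ T.team i, I.network.Adj k m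
  pref : I.StrictPref k (T.act i, (T.team i).card + 1) (T.alt k)
  accepts : T.Accepts I i

theorem closed_of_not_joins {i : Fin n} (h : ∀ k, ¬ T.Joins I i k) : T.Closed I i :=
  fun ha hacc m hm k hk hadj hlt hp => h k ⟨ha, by omega, hk, ⟨m, hm, hadj⟩, hp, hacc⟩

/-- Acceptance makes the enlarged team at least as good for every old member, so all lower bounds on
its value persist by transitivity, and `k` gains by assumption. The changed team has the lowest
positive label, so the properties of the other processed players are inherited. -/
theorem Growing.insert {x : ℕ} {i k : Fin n} (h : T.Growing I x i) (hk : T.Joins I i k) :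
    (T.set i (T.label i) (T.act i) (insert k (T.team i))).Growing I x i := by
  set T' := T.set i (T.label i) (T.act i) (Insert.insert k (T.team i)) with hT'
  have hs := h.sound i h.label_pos
  have hlab : T'.label = T.label := by simp [hT', Plan.set]
  have hact : T'.act = T.act := by simp [hT', Plan.set]
  have hteam : ∀ j, j ≠ i → T'.team j = T.team j := fun j hj => set_team hj
  have hteami : T'.team i = Insert.insert k (T.team i) := set_team_self
  have halti : T'.alt i = (T.act i, (T.team i).card + 1) := by
    simp [hT', Finset.card_insert_of_notMem hk.notMem]
  have hmem := joined_mem hk.notMem hk.act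
  have halt_mem : ∀ j, T.label j ≠ 0 → T.alt j ∈ alternatives n p :=
    fun j hj => (h.sound j hj).alt_mem
  have hlow : ∀ j, T.label j ≠ 0 → T.label i ≤ T.label j := by
    intro j hj
    by_cases hji : j = i
    · rw [hji]
    · exact (h.label_lt j hji hj).le
  have hki : k ≠ i := fun e => hk.notMem (e ▸ hs.self)
  have hmdone : ∀ m ∈ T.team i, T.label m ≠ 0 := by
    intro m hm h0
    have := hs.low m hm
    have := h.label_pos
    omega
  have hsound : T'.Sound I i := by
    have himp : I.weakPref i (T'.alt i) (T.alt i) := by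
      rw [halti]
      exact hk.accepts i hs.self
    have htrans : ∀ y ∈ alternatives n p, I.weakPref i (T.alt i) y →
        I.weakPref i (T'.alt i) y := fun y hy hw =>
      I.transitive i _ (halti ▸ hmem) _ hs.alt_mem _ hy himp hw
    refine ⟨by simp [hteami, hs.self], ?_, ?_, fun h0 => absurd (hact ▸ h0) hk.act, ?_,
      htrans _ void_mem_alternatives hs.rational, fun b => htrans _ (some_mem_alternatives.2
        ⟨le_rfl, by have := i.2; omega⟩) (hs.single b), ?_⟩
    · intro j hj
      rw [hteami, Finset.mem_insert] at hj
      rw [hlab]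
      rcases hj with rfl | hj
      · exact hlow _ hk.done
      · exact hs.low j hj
    · intro j hj hji
      rw [hteami, Finset.mem_insert] at hj
      rw [hlab, hteami]
      rcases hj with rfl | hj
      · obtain ⟨m, hm, hadj⟩ := hk.adj
        refine ⟨m, by simp [hm], hadj, ?_⟩
        rcases lt_trichotomy (T.label m) (T.label j) with hlt | heq | hlt
        · exact hlt
        · exact absurd (h.inj _ _ hk.done heq.symm) hadj.ne
        -- If `j` had the smaller label, it would be the parent of `m`; but the parent of a member
        -- other than the top is already in the team.
        · exfalso
          have hmi : m ≠ i := by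
            rintro rfl
            have := hlow j hk.done
            omega
          obtain ⟨q, hq, hadj', hlt'⟩ := hs.up m hm hmi
          exact hk.notMem (h.upper m j q (hmdone m hm) hadj.symm hadj' hlt hlt' ▸ hq)
      · obtain ⟨m, hm, hadj, hlt⟩ := hs.up j hj hji
        exact ⟨m, by simp [hm], hadj, hlt⟩
    · intro j hj
      rw [hteami, Finset.mem_insert] at hj
      by_cases hji : j = i
      · subst hji
        exact weakPref_refl I j (halti ▸ hmem)
      · rw [halti, hT', set_alt hji]
        rcases hj with rfl | hj
        · exact hk.pref.1
        · exact I.transitive j _ hmem _ hs.alt_mem _ (halt_mem j (hmdone j hj))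
            (hk.accepts j hj) (hs.gain j hj)
    · intro c hadj hlt ha hacc
      have hc : c ≠ i := hadj.ne'
      rw [hlab] at hlt
      rw [hT', set_accepts hc] at hacc
      rw [hact] at ha
      rw [hact, hteam c hc]
      refine htrans _ (joined_mem (k := i) (fun hic => ?_) ha) (hs.child c hadj hlt ha hacc)
      have := (h.sound c (by omega)).low i hic
      omega
  refine ⟨⟨?_, ?_, ?_, ?_⟩, ?_, ?_, ?_, ?_, ?_, ?_⟩
  · simpa only [hlab] using h.range
  · simpa only [hlab] using h.inj
  · simpa only [hlab] using h.card
  · simpa only [hlab] using h.upper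
  · simpa only [hlab] using h.label_pos
  · simpa only [hlab] using h.label_lt
  · intro j hj
    rw [hlab] at hj
    by_cases hji : j = i
    · exact hji ▸ hsound
    · exact (h.sound j hj).set (h.label_lt j hji hj) (h.label_lt j hji hj)
  · intro j hji hj
    rw [hlab] at hj
    exact (h.closed j hji hj).set (h.sound j hj) (h.label_lt j hji hj) (h.label_lt j hji hj)
  · intro j m hji hmi
    rw [hlab, hact, hteam j hji, hteam m hmi]
    exact h.nested j m hji hmi
  · intro j hji
    rw [hlab, hact, hteam j hji, hteami]
    exact fun hj ha hja => (h.covers j hji hj ha hja).trans (Finset.subset_insert _ _)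

/-- The alternative `(α, S.card)` can be the first one for player `i`: being alone or joining the
team of a processed neighbour. -/
def Start (I : GGASP n p) (T : Plan n p) (i : Fin n) (α : Option (Fin p)) (S : Finset (Fin n)) :
    Prop :=
  ((∀ a, α = some a → ¬ T.Used a) ∧ S = {i}) ∨
    ∃ c, I.network.Adj i c ∧ T.label c ≠ 0 ∧ α = T.act c ∧ α ≠ none ∧ T.Accepts I c ∧
      S = insert i (T.team c)

/-- The `x < n` processed players use at most `x` activities, which cannot exhaust the `n` or more
equivalents of `a`. -/
theorem Valid.exists_unused {x : ℕ} (h : T.Valid I x) (hx : x < n)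
    (hI : ∀ a, I.Copyable a) (a : Fin p) :
    ∃ b, ¬ T.Used b ∧ ∀ i, I.weakPref i (some b, 1) (some a, 1) := by
  have hcard : {b | T.Used b}.ncard < {b | I.Equivalent a b}.ncard := by
    refine lt_of_lt_of_le ?_ (hI a)
    refine lt_of_le_of_lt ?_ hx
    have : (some '' {b | T.Used b}) ⊆
        ((Finset.univ.filter fun i => T.label i ≠ 0).image T.act : Finset (Option (Fin p))) := by
      rintro _ ⟨b, ⟨j, hj, hb⟩, rfl⟩
      simp only [Finset.coe_image, Set.mem_image]
      exact ⟨j, by simpa using hj, hb⟩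
    rw [← Set.ncard_image_of_injective _ (Option.some_injective _), ← h.card]
    refine (Set.ncard_le_ncard this (Finset.finite_toSet _)).trans ?_
    rw [Set.ncard_coe_finset]
    exact Finset.card_image_le
  obtain ⟨b, hb, hb'⟩ := Set.exists_mem_notMem_of_ncard_lt_ncard hcard (Set.toFinite _)
  refine ⟨b, hb', fun i => (hb i 1 le_rfl ?_).2⟩
  omega

/-- Either start makes the team of `i` contain all others with its activity: an unused activity has
no other team, and the team of a child `c` contains every processed team with the same activity.
Comparing with unused single activities suffices, since each activity has an unused equivalent. -/
theorem Valid.growing {x : ℕ} {i : Fin n} {α : Option (Fin p)} {S : Finset (Fin n)}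
    (h : T.Valid I x) (hx : x < n) (hI : ∀ a, I.Copyable a) (hi : T.label i = 0)
    (hnext : ∀ j k, I.network.Adj i j → T.label j = 0 → I.network.Adj i k →
      T.label k = 0 → j = k)
    (hstart : T.Start I i α S)
    (hvoid : I.weakPref i (α, S.card) (none, 1))
    (hsingle : ∀ b, ¬ T.Used b → I.weakPref i (α, S.card) (some b, 1))
    (hchild : ∀ c, I.network.Adj i c → T.label c ≠ 0 → T.act c ≠ none → T.Accepts I c →
      I.weakPref i (α, S.card) (T.act c, (T.team c).card + 1)) :
    (T.set i (n - x) α S).Growing I (x + 1) i := by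
  have hbig : ∀ j, T.label j ≠ 0 → n - x < T.label j := fun j hj => (h.range j hj).1
  have hn : 1 ≤ n := by omega
  have hiteam : ∀ j, T.label j ≠ 0 → i ∉ T.team j := by
    intro j hj hij
    have := (h.sound j hj).low i hij
    omega
  have hmd : ∀ c, T.label c ≠ 0 → ∀ k ∈ T.team c, k ≠ i ∧ n - x < T.label k := by
    intro c hc k hk
    have h1 := (h.sound c hc).low k hk
    have := hbig c hc
    refine ⟨?_, by omega⟩
    rintro rfl
    omega
  have hne : ∀ j, T.label j ≠ 0 → j ≠ i := by
    rintro j hj rfl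
    exact hj hi
  have hmem : (α, S.card) ∈ alternatives n p := by
    rcases hstart with ⟨-, rfl⟩ | ⟨c, hadj, hc, rfl, hα, -, rfl⟩
    · cases α with
      | none => exact void_mem_alternatives
      | some a => exact some_mem_alternatives.2 ⟨by simp, by simpa using hn⟩
    · rw [Finset.card_insert_of_notMem (hiteam c hc)]
      exact joined_mem (hiteam c hc) hα
  have hsound : (T.set i (n - x) α S).Sound I i := by
    refine ⟨?_, ?_, ?_, ?_, ?_, by simpa using hvoid, ?_, ?_⟩
    · rw [set_team_self]
      rcases hstart with ⟨-, rfl⟩ | ⟨c, -, -, -, -, -, rfl⟩ <;> simp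
    · intro k hk
      rw [set_team_self] at hk
      by_cases hki : k = i
      · rw [hki]
      · rw [set_label_self, set_label hki]
        rcases hstart with ⟨-, rfl⟩ | ⟨c, -, hc, -, -, -, rfl⟩
        · exact absurd (Finset.mem_singleton.1 hk) hki
        · exact (hmd c hc k ((Finset.mem_insert.1 hk).resolve_left hki)).2.le
    · intro k hk hki
      rw [set_team_self] at hk ⊢
      rcases hstart with ⟨-, rfl⟩ | ⟨c, hadj, hc, -, -, -, rfl⟩
      · exact absurd (Finset.mem_singleton.1 hk) hki
      · have hk' := (Finset.mem_insert.1 hk).resolve_left hki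
        rw [set_label hki]
        by_cases hkc : k = c
        · subst hkc
          exact ⟨i, by simp, hadj.symm, by simpa using hbig k hc⟩
        · obtain ⟨j, hj, hadj', hlt⟩ := (h.sound c hc).up k hk' hkc
          exact ⟨j, by simp [hj], hadj', by rwa [set_label (hmd c hc j hj).1]⟩
    · rw [set_act_self, set_team_self]
      rcases hstart with ⟨-, rfl⟩ | ⟨c, hadj, hc, -, hα, -, rfl⟩
      · simp
      · exact fun h0 => absurd h0 hα
    · intro j hj
      rw [set_team_self] at hj
      by_cases hji : j = i
      · subst hji
        simpa using weakPref_refl I j hmem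
      · rw [set_alt_self, set_alt hji]
        rcases hstart with ⟨-, rfl⟩ | ⟨c, hadj, hc, rfl, hα, hacc, rfl⟩
        · exact absurd (Finset.mem_singleton.1 hj) hji
        · have hj' := (Finset.mem_insert.1 hj).resolve_left hji
          have hjl := (hmd c hc j hj').2
          refine I.transitive j _ hmem _ (h.sound c hc).alt_mem _
            (h.sound j (by omega)).alt_mem ?_ ((h.sound c hc).gain j hj')
          rw [Finset.card_insert_of_notMem (hiteam c hc)]
          exact hacc j hj'
    · intro b
      rw [set_alt_self]
      obtain ⟨b', hb', hw⟩ := h.exists_unused hx hI b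
      exact I.transitive i _ hmem _ (some_mem_alternatives.2 ⟨le_rfl, hn⟩) _
        (some_mem_alternatives.2 ⟨le_rfl, hn⟩) (hsingle b' hb') (hw i)
    · intro c hadj hlt ha hacc
      have hc : c ≠ i := hadj.ne'
      rw [set_accepts hc] at hacc
      rw [set_label hc] at hlt
      rw [set_act hc] at ha ⊢
      rw [set_alt_self, set_team hc]
      exact hchild c hadj (by omega) ha hacc
  have hlab : ∀ j, j ≠ i → (T.set i (n - x) α S).label j ≠ 0 → T.label j ≠ 0 :=
    fun j hji hj => by rwa [set_label hji] at hj
  refine ⟨h.toLayout.set hx hi hnext, ?_, ?_, ?_, ?_, ?_, ?_⟩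
  · simp
    omega
  · intro j hji hj
    rw [set_label_self, set_label hji]
    exact hbig j (hlab j hji hj)
  · intro j hj
    by_cases hji : j = i
    · exact hji ▸ hsound
    · have hj' := hlab j hji hj
      exact (h.sound j hj').set (by omega) (hbig j hj')
  · intro j hji hj
    have hj' := hlab j hji hj
    exact (h.closed j hj').set (h.sound j hj') (by omega) (hbig j hj')
  · intro j k hji hki hj hk
    rw [set_act hji, set_act hki, set_team hji, set_team hki]
    exact h.nested j k (hlab j hji hj) (hlab k hki hk)
  · intro j hji hj
    have hj' := hlab j hji hj
    rw [set_act hji, set_act_self, set_team hji, set_team_self]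
    intro ha hja
    rcases hstart with ⟨hu, rfl⟩ | ⟨c, hadj, hc, rfl, hα, hacc, rfl⟩
    · obtain ⟨a, ha⟩ := Option.ne_none_iff_exists'.1 ha
      exact absurd ⟨j, hj', ha⟩ (hu a (hja ▸ ha))
    · refine (?_ : T.team j ⊆ T.team c).trans (Finset.subset_insert _ _)
      rcases h.nested j c hj' hc ha hja with h' | h'
      · exact h'
      -- A team that contains `c` but has another top would also contain the parent of `c`, which is
      -- `i`; but `i` is not yet processed.
      · have hcj := h' (h.sound c hc).self
        by_cases hjc : c = j
        · rw [hjc]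
        · exfalso
          obtain ⟨m, hm, hadj', hlt⟩ := (h.sound j hj').up c hcj hjc
          have hci := h.upper c i m hc hadj.symm hadj' (by omega) hlt
          exact hiteam j hj' (hci ▸ hm)

/-! ### Choosing the teams of a partition -/

/-- A partial partition of the players into teams that covers the players labelled `1, …, x`. -/
structure Assigning (T : Plan n p) (x : ℕ) (top : Fin n → Option (Fin n)) : Prop where
  mem : ∀ k t, top k = some t → k ∈ T.team t
  label_le : ∀ k t, top k = some t → T.label t ≤ x
  whole : ∀ k t, top k = some t → ∀ j ∈ T.team t, top j = some t
  cover : ∀ i, T.label i ≤ x → top i ≠ none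

theorem Assigning.skip {x : ℕ} {top : Fin n → Option (Fin n)} {i : Fin n}
    (h : T.Assigning x top) (hl : ∀ j, T.label j = x + 1 → j = i) (hi : top i ≠ none) :
    T.Assigning (x + 1) top where
  mem := h.mem
  label_le k t hk := (h.label_le k t hk).trans (Nat.le_succ x)
  whole := h.whole
  cover j hj := by
    rcases Nat.le_succ_iff.1 hj with hj | hj
    · exact h.cover j hj
    · exact hl j hj ▸ hi

/-- The point is that the team of an unassigned `i` avoids all teams chosen before. Their tops have
smaller labels than `i`, so a common member is not the top of the earlier team, and its parent
belongs to that team as well; descending inside the team of `i`, this would reach `i` itself. -/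
theorem Assigning.assign {x : ℕ} {top : Fin n → Option (Fin n)} {i : Fin n} (hT : T.Valid I n)
    (hdone : ∀ j, T.label j ≠ 0)
    (h : T.Assigning x top) (hx : T.label i = x + 1) (hi : top i = none) :
    T.Assigning (x + 1) (fun k => if k ∈ T.team i then some i else top k) := by
  have hs := hT.sound i (hdone i)
  have hfree : ∀ l k, T.label k = l → k ∈ T.team i → top k = none := by
    intro l
    induction l using Nat.strong_induction_on with
    | _ l ih =>
      intro k hl hk
      by_cases hki : k = i
      · rw [hki, hi]
      · obtain ⟨j, hj, hadj, hlt⟩ := hs.up k hk hki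
        have hjn := ih _ (hl ▸ hlt) j rfl hj
        by_contra hcon
        obtain ⟨t, ht⟩ := Option.ne_none_iff_exists'.1 hcon
        have hkt := h.mem k t ht
        have hkne : k ≠ t := by
          rintro rfl
          have := h.label_le k k ht
          have := hs.low k hk
          omega
        obtain ⟨m, hm, hadj', hlt'⟩ := (hT.sound t (hdone t)).up k hkt hkne
        have := h.whole k t ht m hm
        -- `j` and `m` are both the parent of `k`, so the unassigned `j` lies in the chosen team of
        -- `t`.
        rw [← hT.upper k j m (hdone k) hadj hadj' hlt hlt', hjn] at this
        simp at this
  have hcase : ∀ k t, (if k ∈ T.team i then some i else top k) = some t →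
      (k ∈ T.team i ∧ t = i) ∨ (top k = some t ∧ ∀ j ∈ T.team t, j ∉ T.team i) := by
    intro k t hk
    split_ifs at hk with hki
    · exact Or.inl ⟨hki, by simpa using hk.symm⟩
    · refine Or.inr ⟨hk, fun j hj hji => ?_⟩
      have := h.whole k t hk j hj
      rw [hfree _ j rfl hji] at this
      simp at this
  refine ⟨?_, ?_, ?_, ?_⟩
  · intro k t hk
    rcases hcase k t hk with ⟨hk, rfl⟩ | ⟨hk, -⟩
    · exact hk
    · exact h.mem k t hk
  · intro k t hk
    rcases hcase k t hk with ⟨hk, rfl⟩ | ⟨hk, -⟩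
    · exact hx.le
    · exact (h.label_le k t hk).trans (Nat.le_succ x)
  · intro k t hk j hj
    rcases hcase k t hk with ⟨hk, rfl⟩ | ⟨hk, hn⟩
    · simp [hj]
    · rw [if_neg (hn j hj)]
      exact h.whole k t hk j hj
  · intro j hj
    split_ifs with hji
    · simp
    · refine h.cover j ?_
      rcases Nat.le_succ_iff.1 hj with hj | hj
      · exact hj
      · refine absurd (hT.inj j i (hdone j) (hj.trans hx.symm) ▸ hs.self) hji

end Plan

end GGASP

/-! ### Evaluation of expressions and queries -/

namespace RAM

variable {O : Oracle} {s : State}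

@[simp] theorem Expr.eval_const {c : ℕ} : (Expr.const c).eval O s = c := rfl

@[simp] theorem Expr.eval_var {x : ℕ} : (Expr.var x).eval O s = s.var x := rfl

@[simp] theorem Expr.eval_get {a : ℕ} {e : Expr} :
    (Expr.get a e).eval O s = s.arr a (e.eval O s) := rfl

@[simp] theorem Expr.eval_add {e f : Expr} :
    (Expr.add e f).eval O s = e.eval O s + f.eval O s := rfl

@[simp] theorem Expr.eval_sub {e f : Expr} :
    (Expr.sub e f).eval O s = e.eval O s - f.eval O s := rfl

@[simp] theorem Expr.eval_eq_eq_zero {e f : Expr} :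
    (Expr.eq e f).eval O s = 0 ↔ ¬ e.eval O s = f.eval O s := by
  simp only [Expr.eval]
  split_ifs with h <;> simp [h]

@[simp] theorem Expr.eval_pref_eq_zero {i a k b l : Expr} : (Expr.pref i a k b l).eval O s = 0 ↔
    ¬ O.pref (i.eval O s) (a.eval O s) (k.eval O s) (b.eval O s) (l.eval O s) := by
  simp only [Expr.eval]
  split_ifs with h <;> simp [h]

@[simp] theorem Expr.eval_adj_eq_zero {i j : Expr} :
    (Expr.adj i j).eval O s = 0 ↔ ¬ O.adj (i.eval O s) (j.eval O s) := by
  simp only [Expr.eval]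
  split_ifs with h <;> simp [h]

end RAM

namespace GGASP

open RAM

variable {n p : ℕ}

theorem activityCode_injective : Function.Injective (activityCode (p := p)) := by
  rintro (_ | a) (_ | b) h
  · rfl
  · simp [activityCode] at h
  · simp [activityCode] at h
  · simp only [activityCode, Nat.add_right_cancel_iff] at h
    rw [Fin.ext h]

theorem activityCode_eq_zero {α : Option (Fin p)} : activityCode α = 0 ↔ α = none :=
  activityCode_injective.eq_iff' (b := none) rfl

theorem oracle_pref (I : GGASP n p) {i : Fin n} {α β : Option (Fin p)} {k l : ℕ}
    (hx : (α, k) ∈ alternatives n p) (hy : (β, l) ∈ alternatives n p) :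
    I.oracle.pref i (activityCode α) k (activityCode β) l ↔ I.weakPref i (α, k) (β, l) := by
  constructor
  · rintro ⟨i', a', b', hi, ha, hb, -, -, h⟩
    rwa [Fin.ext hi, activityCode_injective ha, activityCode_injective hb] at h
  · exact fun h => ⟨i, α, β, rfl, rfl, rfl, hx, hy, h⟩

theorem oracle_adj (I : GGASP n p) {i j : Fin n} : I.oracle.adj i j ↔ I.network.Adj i j := by
  constructor
  · rintro ⟨i', j', hi, hj, h⟩
    rwa [Fin.ext hi, Fin.ext hj] at h
  · exact fun h => ⟨i, j, rfl, rfl, h⟩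

/-! ### The program

Variables: `0` and `1` hold `n` and `p`, `2` counts rounds, `3` and `4` hold the label and the
number of the current player, `5` and `6` its best alternative, `7` the neighbour whose team it
joins, `8` counts inner rounds, `9` is a multiple of `n`, and the tests use the variables from `10`.
Arrays: `0` holds the output, `1`, `2` and `3` the labels, activities and team sizes, `4` the
membership matrix of the teams with row offsets in `5`, `6` marks the used activities, `7` maps
labels to players, and `8` marks the players with an output. -/

namespace Algorithm

/-- The entry of the membership matrix in the given row and column. -/
def entry (i k : Expr) : Expr := .get 4 (.add (.get 5 i) k)

/-- The negation of an expression used as a test. -/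
def isZero (e : Expr) : Expr := .eq e (.const 0)

/-- The successor of an expression. -/
def succ (e : Expr) : Expr := .add e (.const 1)

/-- Player `i` weakly prefers to join the team of `c` to alternative `(a, l)`. -/
def prefJoin (i c a l : Expr) : Expr := .pref i (.get 2 c) (succ (.get 3 c)) a l

/-- The team of the player in variable `y` accepts a further member. -/
def acceptsTest (w y : ℕ) : Test :=
  .not (.ex 0 (.and (.expr (entry (.var y) (.var w)))
    (.expr (isZero (prefJoin (.var w) (.var y) (.get 2 (.var y)) (.get 3 (.var y)))))))

/-- The player in variable `10` is unprocessed and has at most one unprocessed neighbour. -/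
def nextTest : Test :=
  .and (.expr (isZero (.get 1 (.var 10)))) (.not (.ex 0
    (.and (.expr (.adj (.var 10) (.var 11))) (.and (.expr (isZero (.get 1 (.var 11))))
      (.ex 0 (.and (.expr (.adj (.var 10) (.var 12)))
        (.and (.expr (isZero (.get 1 (.var 12)))) (.expr (isZero (.eq (.var 11) (.var 12)))))))))))

/-- Joining the team of the player in variable `8` is possible for the player in variable `4` and
at least as good as the best alternative so far. -/
def childTest : Test :=
  .and (.expr (.adj (.var 4) (.var 8))) (.and (.expr (.get 1 (.var 8)))
    (.and (.expr (.get 2 (.var 8))) (.and (acceptsTest 10 8)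
      (.expr (prefJoin (.var 4) (.var 8) (.var 5) (.var 6))))))

/-- The player in variable `10` joins the team of the player in variable `4`. -/
def joinsTest : Test :=
  .and (.expr (.get 2 (.var 4))) (.and (.expr (.get 1 (.var 10)))
    (.and (.expr (isZero (entry (.var 4) (.var 10))))
      (.and (.ex 0 (.and (.expr (entry (.var 4) (.var 11))) (.expr (.adj (.var 10) (.var 11)))))
        (.and (.expr (prefJoin (.var 10) (.var 4) (.get 2 (.var 10)) (.get 3 (.var 10))))
          (.and (.expr (isZero (.pref (.var 10) (.get 2 (.var 10)) (.get 3 (.var 10))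
              (.get 2 (.var 4)) (succ (.get 3 (.var 4))))))
            (acceptsTest 11 4))))))

/-- Computation of the row offsets. -/
def rows : Prog :=
  .for 2 0 (.seq (.store 5 (.var 2) (.var 9)) (.assign 9 (.add (.var 9) (.var 0))))

/-- Selection of the best unused activity. -/
def singles : Prog :=
  .for 8 1 (.ite (isZero (.get 6 (succ (.var 8))))
    (.ite (.pref (.var 4) (succ (.var 8)) (.const 1) (.var 5) (.const 1))
      (.assign 5 (succ (.var 8))) .skip) .skip)

/-- Selection of the best team to join. -/
def children : Prog :=
  .for 8 0 (.seq (childTest.prog 10) (.ite (.var 10)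
    (.seq (.assign 5 (.get 2 (.var 8))) (.seq (.assign 6 (succ (.get 3 (.var 8))))
      (.assign 7 (succ (.var 8))))) .skip))

/-- Initialization of the row of the current player by the row of the chosen neighbour. -/
def copy : Prog :=
  .for 8 0 (.ite (.var 7)
    (.store 4 (.add (.get 5 (.var 4)) (.var 8)) (entry (.sub (.var 7) (.const 1)) (.var 8)))
    (.store 4 (.add (.get 5 (.var 4)) (.var 8)) (.const 0)))

/-- Recording of the data of the current player. -/
def record : Prog :=
  .seq (.store 4 (.add (.get 5 (.var 4)) (.var 4)) (.const 1))
    (.seq (.store 1 (.var 4) (.var 3)) (.seq (.store 2 (.var 4) (.var 5))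
      (.seq (.store 3 (.var 4) (.var 6)) (.seq (.store 6 (.var 5) (.const 1))
        (.store 7 (.var 3) (.var 4))))))

/-- Growth of the team of the current player. -/
def grow : Prog :=
  .for 8 0 (.seq ((Test.ex 0 joinsTest).prog 10) (.ite (.var 10)
    (.seq (.store 4 (.add (.get 5 (.var 4)) (.sub (.var 10) (.const 1))) (.const 1))
      (.store 3 (.var 4) (succ (.get 3 (.var 4))))) .skip))

/-- Processing of a player. -/
def round : Prog :=
  .seq ((Test.ex 0 nextTest).prog 10) (.seq (.assign 4 (.sub (.var 10) (.const 1)))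
    (.seq (.assign 3 (.sub (.var 0) (.var 2))) (.seq (.assign 5 (.const 0))
      (.seq (.assign 6 (.const 1)) (.seq (.assign 7 (.const 0))
        (.seq singles (.seq children (.seq (.seq copy record) grow))))))))

/-- Output of the team of the current player. -/
def output : Prog :=
  .for 8 0 (.ite (entry (.var 4) (.var 8))
    (.seq (.store 0 (.var 8) (.get 2 (.var 4))) (.store 8 (.var 8) (.const 1))) .skip)

/-- Choice of the teams from the top down. -/
def choose : Prog :=
  .for 2 0 (.seq (.assign 4 (.get 7 (succ (.var 2)))) (.ite (.get 8 (.var 4)) .skip output))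

/-- The program. -/
def main : Prog := .seq rows (.seq (.for 2 0 round) choose)

/-- The memory state represents the plan. -/
structure Represents (s : State) (T : Plan n p) : Prop where
  players : s.var 0 = n
  activities : s.var 1 = p
  label : ∀ i : Fin n, s.arr 1 i = T.label i
  act : ∀ i : Fin n, s.arr 2 i = activityCode (T.act i)
  size : ∀ i : Fin n, s.arr 3 i = (T.team i).card
  table : ∀ i k : Fin n, s.arr 4 (i * n + k) ≠ 0 ↔ k ∈ T.team i
  row : ∀ i : Fin n, s.arr 5 i = i * n
  used : ∀ b : Fin p, s.arr 6 (b + 1) ≠ 0 ↔ T.Used b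

/-! ### Tests evaluated on a represented plan -/

variable {s s' : State} {T : Plan n p} {I : GGASP n p}

theorem Represents.congr (h : Represents s T) (h0 : s'.var 0 = s.var 0) (h1 : s'.var 1 = s.var 1)
    (ha : ∀ a, 1 ≤ a → a ≤ 6 → s'.arr a = s.arr a) : Represents s' T where
  players := h0.trans h.players
  activities := h1.trans h.activities
  label := by simpa [ha 1] using h.label
  act := by simpa [ha 2] using h.act
  size := by simpa [ha 3] using h.size
  table := by simpa [ha 4] using h.table
  row := by simpa [ha 5] using h.row
  used := by simpa [ha 6] using h.used

theorem Represents.agree {w : ℕ} (h : Represents s T) (hw : 2 ≤ w) (ha : AgreeBelow w s s') :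
    Represents s' T :=
  h.congr (ha.var 0 (by omega)) (ha.var 1 (by omega)) fun a _ _ => by rw [ha.arr]

theorem Represents.setVar (h : Represents s T) {x k : ℕ} (hx : 2 ≤ x) :
    Represents (s.setVar x k) T :=
  h.congr (by simp; omega) (by simp; omega) fun a _ _ => rfl

theorem Represents.bound (h : Represents s T) : ∀ b < 2, s.var b ≤ n + p := by
  intro b hb
  interval_cases b
  · rw [h.players]; omega
  · rw [h.activities]; omega

theorem entry_eval {O : Oracle} (h : Represents s T) {e f : Expr} {i k : Fin n}
    (he : e.eval O s = i) (hf : f.eval O s = k) : (entry e f).eval O s ≠ 0 ↔ k ∈ T.team i := by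
  simp only [entry, Expr.eval_get, Expr.eval_add, he, hf, h.row]
  exact h.table i k

theorem isZero_eval {O : Oracle} {e : Expr} : (isZero e).eval O s ≠ 0 ↔ e.eval O s = 0 := by
  simp [isZero]

theorem isZero_eval_iff {O : Oracle} {e : Expr} {Q : Prop} (h : e.eval O s ≠ 0 ↔ Q) :
    (isZero e).eval O s ≠ 0 ↔ ¬ Q := by
  rw [isZero_eval, ← h, not_not]

/-- Earlier conjuncts of a test guarantee that later queries concern genuine alternatives; on others
the oracle answers negatively whatever the preferences are. -/
theorem and_congr_imp {a b c d : Prop} (h : a ↔ c) (h' : c → (b ↔ d)) : a ∧ b ↔ c ∧ d := by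
  rw [h]
  exact and_congr_right h'

theorem adj_eval {e f : Expr} {i j : Fin n} (he : e.eval I.oracle s = i)
    (hf : f.eval I.oracle s = j) :
    (Expr.adj e f).eval I.oracle s ≠ 0 ↔ I.network.Adj i j := by
  simp [he, hf, oracle_adj]

theorem pref_eval {e a k b l : Expr} {i : Fin n} {α β : Option (Fin p)} {x y : ℕ}
    (he : e.eval I.oracle s = i) (ha : a.eval I.oracle s = activityCode α)
    (hk : k.eval I.oracle s = x) (hb : b.eval I.oracle s = activityCode β)
    (hl : l.eval I.oracle s = y) (hx : (α, x) ∈ alternatives n p)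
    (hy : (β, y) ∈ alternatives n p) :
    (Expr.pref e a k b l).eval I.oracle s ≠ 0 ↔ I.weakPref i (α, x) (β, y) := by
  simp [he, ha, hk, hb, hl, oracle_pref I hx hy]

theorem prefJoin_eval (h : Represents s T) {e f b l : Expr} {i c : Fin n} {β : Option (Fin p)}
    {y : ℕ} (he : e.eval I.oracle s = i) (hf : f.eval I.oracle s = c)
    (hb : b.eval I.oracle s = activityCode β) (hl : l.eval I.oracle s = y)
    (hx : (T.act c, (T.team c).card + 1) ∈ alternatives n p) (hy : (β, y) ∈ alternatives n p) :
    (prefJoin e f b l).eval I.oracle s ≠ 0 ↔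
      I.weakPref i (T.act c, (T.team c).card + 1) (β, y) :=
  pref_eval he (by simp [hf, h.act]) (by simp [succ, hf, h.size]) hb hl hx hy

theorem exists_lt_iff {P : ℕ → Prop} : (∃ k < n, P k) ↔ ∃ k : Fin n, P k :=
  ⟨fun ⟨k, hk, h⟩ => ⟨⟨k, hk⟩, h⟩, fun ⟨k, h⟩ => ⟨k, k.2, h⟩⟩

theorem accepts_holds (h : Represents s T) {w y : ℕ} {c : Fin n} (hw : 2 ≤ w) (hyw : y < w)
    (hy : s.var y = c) (hc : T.Sound I c)
    (hx : (T.act c, (T.team c).card + 1) ∈ alternatives n p) :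
    (acceptsTest w y).Holds I.oracle w s ↔ T.Accepts I c := by
  have key : ∀ k : Fin n, ((entry (.var y) (.var w)).eval I.oracle (s.setVar w k) ≠ 0 ∧
      (isZero (prefJoin (.var w) (.var y) (.get 2 (.var y)) (.get 3 (.var y)))).eval I.oracle
        (s.setVar w k) ≠ 0) ↔ k ∈ T.team c ∧
      ¬ I.weakPref k (T.act c, (T.team c).card + 1) (T.act c, (T.team c).card) := by
    intro k
    have hy' : (Expr.var y).eval I.oracle (s.setVar w k) = c := by simp [hyw.ne, hy]
    have hk : (Expr.var w).eval I.oracle (s.setVar w k) = k := by simp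
    have hr := h.setVar (k := k) hw
    exact and_congr (entry_eval hr hy' hk) (isZero_eval_iff (prefJoin_eval hr hk hy'
      (by simp [hyw.ne, hy, h.act]) (by simp [hyw.ne, hy, h.size]) hx hc.alt_mem))
  simp only [acceptsTest, Test.Holds, h.players, exists_lt_iff, key, Plan.Accepts]
  push Not
  rfl

theorem next_holds (h : Represents s T) (i : Fin n) :
    nextTest.Holds I.oracle 11 (s.setVar 10 i) ↔ T.label i = 0 ∧ ∀ j k, I.network.Adj i j →
      T.label j = 0 → I.network.Adj i k → T.label k = 0 → j = k := by
  simp only [nextTest, Test.Holds, isZero_eval]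
  simp [h.players, exists_lt_iff, h.label, oracle_adj, Fin.val_inj]
  grind

theorem runs_next (h : Represents s T) {x : ℕ} (hT : T.Layout I x) (hx : x < n)
    (hI : I.network.IsAcyclic) :
    Runs I.oracle (n + p) ((Test.ex 0 nextTest).prog 10) s (fun s' => AgreeBelow 10 s s' ∧
      ∃ i : Fin n, s'.var 10 = i + 1 ∧ T.label i = 0 ∧ ∀ j k, I.network.Adj i j →
        T.label j = 0 → I.network.Adj i k → T.label k = 0 → j = k) := by
  refine (Runs.find 0 nextTest 10 (by omega) h.bound rfl).imp ?_
  rintro s' - ⟨hag, ⟨-, h'⟩ | ⟨k, hk, hP, hv⟩⟩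
  · obtain ⟨i, hi⟩ := hT.exists_next hx hI
    exact absurd ((next_holds h i).2 hi) (h' i (h.players ▸ i.2))
  · rw [h.players] at hk
    exact ⟨hag, ⟨k, hk⟩, hv, (next_holds h ⟨k, hk⟩).1 hP⟩

end Algorithm

end GGASP

/-! ### Correctness of the loops that process a player -/

namespace GGASP

open RAM

variable {n p : ℕ}

namespace Algorithm

variable {s s' : State} {T : Plan n p} {I : GGASP n p}

theorem Represents.frame (h : Represents s T) {c : Prog} (hf : Frame c s s')
    (hc : (c.keepsVar 0 && (c.keepsVar 1 &&
      (List.range 6).all fun a => c.keepsArr (a + 1))) = true) : Represents s' T := by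
  simp only [Bool.and_eq_true, List.all_eq_true, List.mem_range] at hc
  refine h.congr (hf.var 0 hc.1) (hf.var 1 hc.2.1) fun a h1 h6 => hf.arr a ?_
  have := hc.2.2 (a - 1) (by omega)
  rwa [Nat.sub_add_cancel h1] at this

theorem single_mem {a : Fin p} (i : Fin n) : (some a, 1) ∈ alternatives n p :=
  some_mem_alternatives.2 ⟨le_rfl, by have := i.2; omega⟩

/-- The best alternative of player `i` among being alone and the unused activities below `k`. -/
structure BestSingle (I : GGASP n p) (T : Plan n p) (i : Fin n) (k : ℕ) (α : Option (Fin p)) :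
    Prop where
  unused : ∀ a, α = some a → ¬ T.Used a
  rational : I.weakPref i (α, 1) (none, 1)
  single : ∀ b : Fin p, b.val < k → ¬ T.Used b → I.weakPref i (α, 1) (some b, 1)

theorem BestSingle.mem {i : Fin n} {k : ℕ} {α : Option (Fin p)} (_ : BestSingle I T i k α) :
    (α, 1) ∈ alternatives n p := by
  cases α with
  | none => exact void_mem_alternatives
  | some a => exact single_mem i

theorem BestSingle.succ {i : Fin n} {a : Fin p} {α : Option (Fin p)}
    (h : BestSingle I T i a α) (ha : ¬ T.Used a → I.weakPref i (α, 1) (some a, 1)) :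
    BestSingle I T i (a + 1) α where
  unused := h.unused
  rational := h.rational
  single b hb hu := by
    rcases Nat.lt_succ_iff_lt_or_eq.1 hb with hb | hb
    · exact h.single b hb hu
    · rw [Fin.ext hb] at hu ⊢
      exact ha hu

/-- A running maximum that starts from the void activity; by completeness, a failed comparison gives
the reverse preference. -/
theorem runs_singles (h : Represents s T) {i : Fin n} (hi : s.var 4 = i) (h5 : s.var 5 = 0) :
    Runs I.oracle (n + p) singles s
      (fun s' => ∃ α, s'.var 5 = activityCode α ∧ BestSingle I T i p α) := by
  refine (Runs.for (fun k s' => ∃ α, s'.var 5 = activityCode α ∧ BestSingle I T i k α)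
    (h.bound 1 (by omega)) rfl rfl ?_ ?_).imp fun s' _ h' => h.activities ▸ h'
  · exact ⟨none, by simp [h5, activityCode], ⟨by simp, weakPref_refl I i void_mem_alternatives,
      by simp⟩⟩
  · rintro k s' hk h8 hf ⟨α, hα, hbest⟩
    rw [h.activities] at hk
    lift k to Fin p using hk
    have hr : Represents s' T := h.frame hf rfl
    have h4 : s'.var 4 = i := (hf.var 4 rfl).trans hi
    have hused : (isZero (.get 6 (succ (.var 8)))).eval I.oracle s' ≠ 0 ↔ ¬ T.Used k := by
      rw [isZero_eval, ← hr.used k]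
      simp [succ, h8]
    have hpref : (Expr.pref (.var 4) (succ (.var 8)) (.const 1) (.var 5) (.const 1)).eval
        I.oracle s' ≠ 0 ↔ I.weakPref i (some k, 1) (α, 1) :=
      pref_eval (by simp [h4]) (by simp [succ, h8, activityCode]) (by simp) (by simp [hα])
        (by simp) (single_mem i) hbest.mem
    refine Runs.ite (fun hu => ?_) fun hu => Runs.skip ⟨α, by simpa using hα,
      hbest.succ fun hu' => absurd hu (hused.2 hu')⟩
    refine Runs.ite (fun hp => Runs.assign ?_) fun hp => Runs.skip ⟨α, by simpa using hα,
      hbest.succ fun _ => ?_⟩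
    · have hw := hpref.1 hp
      have hmem := single_mem (a := k) i
      refine ⟨some k, by simp [succ, h8, activityCode], BestSingle.succ ⟨?_, ?_, ?_⟩
        fun _ => weakPref_refl I i hmem⟩
      · rintro a ha
        rw [← Option.some.inj ha]
        exact hused.1 hu
      · exact I.transitive i _ hmem _ hbest.mem _ void_mem_alternatives hw hbest.rational
      · exact fun b hb hub => I.transitive i _ hmem _ hbest.mem _ (single_mem i) hw
          (hbest.single b hb hub)
    · exact (I.complete i _ hbest.mem _ (single_mem i)).resolve_right
        fun hw => hpref.2 hw hp

/-- The first alternative chosen for player `i` is `(α, S.card)`. -/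
def Chosen (I : GGASP n p) (T : Plan n p) (i : Fin n) (α : Option (Fin p))
    (S : Finset (Fin n)) (s : State) : Prop :=
  s.var 5 = activityCode α ∧ s.var 6 = S.card ∧
    ((s.var 7 = 0 ∧ (∀ a, α = some a → ¬ T.Used a) ∧ S = {i}) ∨
      ∃ c : Fin n, s.var 7 = c + 1 ∧ I.network.Adj i c ∧ T.label c ≠ 0 ∧ α = T.act c ∧ α ≠ none ∧
        T.Accepts I c ∧ S = insert i (T.team c))

theorem Chosen.start {i : Fin n} {α : Option (Fin p)} {S : Finset (Fin n)}
    (h : Chosen I T i α S s) : T.Start I i α S := by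
  rcases h.2.2 with ⟨-, h⟩ | ⟨c, -, h⟩
  · exact Or.inl h
  · exact Or.inr ⟨c, h⟩

theorem notMem_team {x : ℕ} {i c : Fin n} (hT : T.Valid I x) (hi : T.label i = 0)
    (hc : T.label c ≠ 0) : i ∉ T.team c := fun h => by
  have := (hT.sound c hc).low i h
  omega

theorem child_holds {x m : ℕ} {i c : Fin n} {α : Option (Fin p)} (h : Represents s T)
    (hT : T.Valid I x) (hi : T.label i = 0) (h4 : s.var 4 = i) (h8 : s.var 8 = c)
    (h5 : s.var 5 = activityCode α) (h6 : s.var 6 = m) (hm : (α, m) ∈ alternatives n p) :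
    childTest.Holds I.oracle 10 s ↔ I.network.Adj i c ∧ T.label c ≠ 0 ∧ T.act c ≠ none ∧
      T.Accepts I c ∧ I.weakPref i (T.act c, (T.team c).card + 1) (α, m) := by
  simp only [childTest, Test.Holds]
  refine and_congr_imp (adj_eval (by simp [h4]) (by simp [h8])) fun hadj => ?_
  rw [Expr.eval_get, Expr.eval_var, h8, h.label]
  refine and_congr_right fun hc => ?_
  rw [Expr.eval_get, Expr.eval_var, h8, h.act, Ne, activityCode_eq_zero]
  refine and_congr_right fun ha => ?_
  have hmem := Plan.joined_mem (notMem_team hT hi hc) ha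
  exact and_congr (accepts_holds h (by omega) (by omega) h8 (hT.sound c hc) hmem)
    (prefJoin_eval h (by simp [h4]) (by simp [h8]) (by simp [h5]) (by simp [h6]) hmem hm)

theorem Chosen.mem {x : ℕ} {i : Fin n} {α : Option (Fin p)} {S : Finset (Fin n)}
    (h : Chosen I T i α S s) (hT : T.Valid I x) (hi : T.label i = 0) :
    (α, S.card) ∈ alternatives n p := by
  rcases h.2.2 with ⟨-, -, rfl⟩ | ⟨c, -, -, hc, rfl, hα, -, rfl⟩
  · cases α with
    | none => exact void_mem_alternatives
    | some a => exact single_mem i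
  · rw [Finset.card_insert_of_notMem (notMem_team hT hi hc)]
    exact Plan.joined_mem (notMem_team hT hi hc) hα

/-- Player `i` likes `y` at least as much as being alone and as joining one of the first `k`
players. -/
structure BestStart (I : GGASP n p) (T : Plan n p) (i : Fin n) (k : ℕ)
    (y : Option (Fin p) × ℕ) : Prop where
  rational : I.weakPref i y (none, 1)
  single : ∀ b, ¬ T.Used b → I.weakPref i y (some b, 1)
  child : ∀ c : Fin n, c.val < k → I.network.Adj i c → T.label c ≠ 0 → T.act c ≠ none →
    T.Accepts I c → I.weakPref i y (T.act c, (T.team c).card + 1)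

theorem BestStart.succ {i c : Fin n} {y : Option (Fin p) × ℕ} (h : BestStart I T i c y)
    (hc : I.network.Adj i c → T.label c ≠ 0 → T.act c ≠ none →
      T.Accepts I c → I.weakPref i y (T.act c, (T.team c).card + 1)) :
    BestStart I T i (c + 1) y where
  rational := h.rational
  single := h.single
  child b hb := by
    rcases Nat.lt_succ_iff_lt_or_eq.1 hb with hb | hb
    · exact h.child b hb
    · rw [Fin.ext hb]
      exact hc

/-- The running maximum goes on over the teams of processed neighbours, seeded with the best single
alternative. Variable `7` remembers the neighbour plus one, with `0` meaning none. -/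
theorem runs_children {x : ℕ} (h : Represents s T) (hT : T.Valid I x) {i : Fin n}
    {α : Option (Fin p)} (hl : T.label i = 0) (hi : s.var 4 = i) (h5 : s.var 5 = activityCode α)
    (hα : BestSingle I T i p α) (h6 : s.var 6 = 1) (h7 : s.var 7 = 0) :
    Runs I.oracle (n + p) children s
      (fun s' => ∃ α S, Chosen I T i α S s' ∧ BestStart I T i n (α, S.card)) := by
  refine (Runs.for
    (fun k s' => ∃ α S, Chosen I T i α S s' ∧ BestStart I T i k (α, S.card))
    (h.bound 0 (by omega)) rfl rfl ?_ ?_).imp fun s' _ h' => h.players ▸ h'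
  · refine ⟨α, {i}, ⟨by simp [h5], by simp [h6], Or.inl ⟨by simp [h7], hα.unused, rfl⟩⟩, ?_⟩
    rw [Finset.card_singleton]
    exact ⟨hα.rational, fun b => hα.single b b.2, by simp⟩
  · rintro c s' hk h8 hf ⟨α, S, hch, hbest⟩
    rw [h.players] at hk
    lift c to Fin n using hk
    have hr : Represents s' T := h.frame hf rfl
    have h4 : s'.var 4 = i := (hf.var 4 rfl).trans hi
    have hmem := hch.mem hT hl
    have hholds := child_holds hr hT hl h4 h8 hch.1 hch.2.1 hmem
    refine Runs.seq (Runs.test childTest 10 (by omega) hr.bound rfl) ?_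
    rintro s1 - ⟨hag, hv⟩
    rw [hholds] at hv
    have hch1 : Chosen I T i α S s1 := by
      unfold Chosen
      rw [hag.var 5 (by omega), hag.var 6 (by omega), hag.var 7 (by omega)]
      exact hch
    refine Runs.ite (fun hc => ?_) fun hc => Runs.skip ⟨α, S, by simpa [Chosen] using hch1,
      hbest.succ fun hadj hc0 ha hacc => ?_⟩
    · obtain ⟨hadj, hc0, ha, hacc, hw⟩ := hv.1 hc
      have h81 : s1.var 8 = c := (hag.var 8 (by omega)).trans h8
      have hr1 := hr.agree (by omega) hag
      have hic := notMem_team hT hl hc0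
      have hmemc := Plan.joined_mem hic ha
      refine Runs.assign_seq (Runs.assign_seq (Runs.assign ⟨T.act c, insert i (T.team c), ?_, ?_⟩))
      · refine ⟨by simp [h81, hr1.act], ?_, Or.inr ⟨c, ?_, hadj, hc0, rfl, ha, hacc, rfl⟩⟩
        · simp [succ, h81, hr1.size, Finset.card_insert_of_notMem hic]
        · simp [succ, h81]
      · rw [Finset.card_insert_of_notMem hic]
        have htrans : ∀ y ∈ alternatives n p, I.weakPref i (α, S.card) y →
            I.weakPref i (T.act c, (T.team c).card + 1) y :=
          fun y hy => I.transitive i _ hmemc _ hmem _ hy hw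
        refine BestStart.succ ⟨htrans _ void_mem_alternatives hbest.rational,
          fun b hb => htrans _ (single_mem i) (hbest.single b hb),
          fun b hb hadj' hb0 hb' hacc' => htrans _ (Plan.joined_mem (notMem_team hT hl hb0) hb')
            (hbest.child b hb hadj' hb0 hb' hacc')⟩ fun _ _ _ _ => weakPref_refl I i hmemc
    · exact (I.complete i _ hmem _ (Plan.joined_mem (notMem_team hT hl hc0) ha)).resolve_right
        fun hw => hv.2 ⟨hadj, hc0, ha, hacc, hw⟩ hc

/-- Uniqueness of quotient and remainder modulo `n`: rows of the membership matrix do not overlap.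
-/
theorem index_inj {i j k l : Fin n} : (i * n + k : ℕ) = j * n + l ↔ i = j ∧ k = l := by
  constructor
  · intro h
    have hn : 0 < n := by have := i.2; omega
    have h1 := congrArg (· % n) h
    have h2 := congrArg (· / n) h
    simp only [Nat.mul_add_mod_self_right, Nat.mod_eq_of_lt k.2, Nat.mod_eq_of_lt l.2] at h1
    rw [mul_comm (i : ℕ), mul_comm (j : ℕ)] at h2
    simp only [Nat.mul_add_div hn, Nat.div_eq_of_lt k.2, Nat.div_eq_of_lt l.2] at h2
    exact ⟨Fin.ext (by omega), Fin.ext h1⟩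
  · rintro ⟨rfl, rfl⟩
    rfl

/-- The diagonal cell of `i` is exempt: `i` does not belong to the copied team, and `record` sets
this cell afterwards. -/
theorem runs_copy (h : Represents s T) {i : Fin n} {α : Option (Fin p)}
    {S : Finset (Fin n)} (hi : s.var 4 = i) (hl : T.label i = 0) (hch : Chosen I T i α S s) :
    Runs I.oracle (n + p) copy s (fun s' => ∀ j k : Fin n, j ≠ i ∨ k ≠ i →
      (s'.arr 4 (j * n + k) ≠ 0 ↔ k ∈ if j = i then S else T.team j)) := by
  refine (Runs.for (fun m s' => ∀ j k : Fin n, (j = i → k.val < m) → j ≠ i ∨ k ≠ i →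
      (s'.arr 4 (j * n + k) ≠ 0 ↔ k ∈ if j = i then S else T.team j))
    (h.bound 0 (by omega)) rfl rfl ?_ ?_).imp ?_
  · intro j k hj _
    have hji : j ≠ i := fun e => by simpa using hj e
    simpa [hji] using h.table j k
  · intro m s' hm h8 hf hJ
    rw [h.players] at hm
    lift m to Fin n using hm
    have h4 : s'.var 4 = i := (hf.var 4 rfl).trans hi
    have h7 : s'.var 7 = s.var 7 := hf.var 7 rfl
    have h5 : ∀ j : Fin n, s'.arr 5 j = j * n := fun j => by rw [hf.arr 5 rfl, h.row]
    have key : ∀ v : ℕ, (m ≠ i → (v ≠ 0 ↔ m ∈ S)) → ∀ s'' : State,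
        s'' = (s'.setArr 4 (i * n + m) v).setVar 8 (m + 1) → ∀ j k : Fin n,
        (j = i → k.val < m + 1) → j ≠ i ∨ k ≠ i →
        (s''.arr 4 (j * n + k) ≠ 0 ↔ k ∈ if j = i then S else T.team j) := by
      rintro v hv s'' rfl j k hk hjk
      simp only [State.setVar_arr, State.setArr_arr, true_and, index_inj]
      by_cases hjm : j = i ∧ k = m
      · obtain ⟨rfl, rfl⟩ := hjm
        simpa using hv (by simpa using hjk)
      · rw [if_neg hjm]
        refine hJ j k (fun hj => ?_) hjk
        have := hk hj
        have : k.val ≠ m.val := fun e => hjm ⟨hj, Fin.ext e⟩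
        omega
    rcases hch.2.2 with ⟨h70, -, hS⟩ | ⟨c, h7c, hadj, hc, -, -, -, hS⟩
    · refine Runs.ite (fun h0 => absurd (h7.trans h70) h0) fun _ => Runs.store ?_
      exact key 0 (fun hmi => by simp [hS, hmi]) _ (by simp [h4, h5, h8])
    · refine Runs.ite (fun _ => Runs.store ?_) fun h0 => ?_
      -- The source row differs from the row being written, so it is still intact.
      · have hci : c ≠ i := hadj.ne'
        have hJc := hJ c m (fun e => absurd e hci) (Or.inl hci)
        refine key (s'.arr 4 (c * n + m)) (fun hmi => ?_) _ ?_
        · rw [hJc, if_neg hci, hS, Finset.mem_insert]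
          tauto
        · simp [h4, h5, h8, entry, h7, h7c]
      · rw [Expr.eval_var, h7, h7c] at h0
        omega
  · intro s' _ hJ j k
    exact hJ j k fun _ => by rw [h.players]; exact k.2

theorem used_set {i : Fin n} {l : ℕ} {α : Option (Fin p)} {S : Finset (Fin n)} {b : Fin p}
    (hi : T.label i = 0) (hl : l ≠ 0) :
    (T.set i l α S).Used b ↔ T.Used b ∨ α = some b := by
  constructor
  · rintro ⟨j, hj, hb⟩
    by_cases hji : j = i
    · subst hji
      exact Or.inr (by simpa using hb)
    · exact Or.inl ⟨j, by simpa [Plan.set_label hji] using hj,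
        by simpa [Plan.set_act hji] using hb⟩
  · rintro (⟨j, hj, hb⟩ | hb)
    · have hji : j ≠ i := by
        rintro rfl
        exact hj hi
      exact ⟨j, by simpa [Plan.set_label hji] using hj, by simpa [Plan.set_act hji] using hb⟩
    · exact ⟨i, by simpa using hl, by simpa using hb⟩

theorem runs_record (h : Represents s T) {i : Fin n} {l : ℕ} {α : Option (Fin p)}
    {S : Finset (Fin n)} (hi : s.var 4 = i) (h3 : s.var 3 = l) (hl : T.label i = 0) (hl0 : l ≠ 0)
    (hch : Chosen I T i α S s) :
    Runs I.oracle (n + p) (.seq copy record) s (fun s' => Represents s' (T.set i l α S) ∧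
      s'.arr 7 = Function.update (s.arr 7) l i) := by
  refine Runs.seq (runs_copy h hi hl hch) fun s1 hf htab => ?_
  have h1 : ∀ a, a ≠ 4 → s1.arr a = s.arr a := fun a ha => hf.arr a (by
    simp [copy, Prog.for, Prog.keepsArr, ha.symm])
  have h4 : s1.var 4 = i := (hf.var 4 rfl).trans hi
  have h3' : s1.var 3 = l := (hf.var 3 rfl).trans h3
  have h5 : s1.var 5 = activityCode α := (hf.var 5 rfl).trans hch.1
  have h6 : s1.var 6 = S.card := (hf.var 6 rfl).trans hch.2.1
  have hiS : i ∈ S := by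
    rcases hch.2.2 with ⟨-, -, rfl⟩ | ⟨c, -, -, -, -, -, -, rfl⟩ <;> simp
  refine Runs.store_seq (Runs.store_seq (Runs.store_seq (Runs.store_seq (Runs.store_seq
    (Runs.store ⟨⟨?_, ?_, ?_, ?_, ?_, ?_, ?_, ?_⟩, ?_⟩)))))
  · simpa using (hf.var 0 rfl).trans h.players
  · simpa using (hf.var 1 rfl).trans h.activities
  · intro j
    by_cases hji : j = i <;>
      simp [h4, h3', hji, Fin.val_inj, h1, h.label, Plan.set_label]
  · intro j
    by_cases hji : j = i <;>
      simp [h4, h5, hji, Fin.val_inj, h1, h.act, Plan.set_act]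
  · intro j
    by_cases hji : j = i <;>
      simp [h4, h6, hji, Fin.val_inj, h1, h.size, Plan.set_team]
  · intro j k
    simp only [State.setArr_arr, Expr.eval_add, Expr.eval_get, Expr.eval_var, State.setArr_var, h4,
      h1 5 (by omega), h.row, index_inj, true_and]
    by_cases hjk : j = i ∧ k = i
    · simp [hjk, hiS]
    · simp only [hjk]
      have := htab j k (by tauto)
      by_cases hji : j = i
      · subst hji
        simpa using this
      · simpa [hji, Plan.set_team hji] using this
  · intro j
    simp [h1, h.row]
  · intro b
    rw [used_set hl hl0, ← h.used b]
    -- Codes of non-void activities start at `1`; a void choice marks cell `0`, which stands for no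
    -- element of `Fin p`.
    have : (b : ℕ) + 1 = activityCode α ↔ α = some b :=
      ⟨fun e => activityCode_injective (e.symm : activityCode α = activityCode (some b)),
        fun e => e ▸ rfl⟩
    rw [← this]
    by_cases hb : (b : ℕ) + 1 = activityCode α <;> simp [h1, h5, hb]
  · ext m
    by_cases hm : m = l <;> simp [h3', h4, hm, h1]

theorem joins_holds {x : ℕ} {i k : Fin n} (h : Represents s T) (hT : T.Growing I x i)
    (hi : s.var 4 = i) :
    joinsTest.Holds I.oracle 11 (s.setVar 10 k) ↔ T.Joins I i k := by
  have hr := h.setVar (x := 10) (k := k) (by omega)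
  set s1 := s.setVar 10 k with hs1
  have h4 : s1.var 4 = i := by simp [hs1, hi]
  have h10 : s1.var 10 = k := by simp [hs1]
  have hjoin : T.Joins I i k ↔ T.act i ≠ none ∧ T.label k ≠ 0 ∧ k ∉ T.team i ∧
      (∃ m, m ∈ T.team i ∧ I.network.Adj k m) ∧
      I.weakPref k (T.act i, (T.team i).card + 1) (T.alt k) ∧
      ¬ I.weakPref k (T.alt k) (T.act i, (T.team i).card + 1) ∧ T.Accepts I i :=
    ⟨fun ⟨a, b, c, d, e, f⟩ => ⟨a, b, c, d, e.1, e.2, f⟩,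
      fun ⟨a, b, c, d, e, e', f⟩ => ⟨a, b, c, d, ⟨e, e'⟩, f⟩⟩
  rw [hjoin]
  simp only [joinsTest, Test.Holds]
  rw [Expr.eval_get, Expr.eval_var, h4, hr.act, Ne, activityCode_eq_zero]
  refine and_congr_right fun ha => ?_
  rw [Expr.eval_get, Expr.eval_var, h10, hr.label]
  refine and_congr_right fun hk => ?_
  refine and_congr_imp (isZero_eval_iff (entry_eval hr (by simp [h4]) (by simp [h10])))
    fun hki => ?_
  have hmem := Plan.joined_mem hki ha
  have hkmem : (T.act k, (T.team k).card) ∈ alternatives n p := (hT.sound k hk).alt_mem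
  refine and_congr ?_ (and_congr ?_ (and_congr ?_ ?_))
  · rw [hr.players, exists_lt_iff]
    refine exists_congr fun m => ?_
    have hr' := hr.setVar (x := 11) (k := m) (by omega)
    exact and_congr (entry_eval hr' (by simp [h4]) (by simp))
      (adj_eval (by simp [h10]) (by simp))
  · exact prefJoin_eval hr (by simp [h10]) (by simp [h4]) (by simp [h10, hr.act])
      (by simp [h10, hr.size]) hmem hkmem
  · exact isZero_eval_iff (pref_eval (by simp [h10]) (by simp [h10, hr.act])
      (by simp [h10, hr.size]) (by simp [h4, hr.act]) (by simp [succ, h4, hr.size]) hkmem hmem)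
  · exact accepts_holds hr (by omega) (by omega) h4 (hT.sound i hT.label_pos) hmem

/-- Until nobody wants to join, each round adds a member, so `n` rounds are enough. Further rounds
do nothing. -/
theorem runs_grow {x : ℕ} {i : Fin n} (h : Represents s T) (hT : T.Growing I x i)
    (hi : s.var 4 = i) :
    Runs I.oracle (n + p) grow s (fun s' => ∃ T' : Plan n p, Represents s' T' ∧
      T'.Valid I x ∧ T'.label = T.label) := by
  refine (Runs.for (fun m s' => ∃ T' : Plan n p, Represents s' T' ∧ T'.Growing I x i ∧
    T'.label = T.label ∧ ((∀ k, ¬ T'.Joins I i k) ∨ m + 1 ≤ (T'.team i).card))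
    (h.bound 0 (by omega)) rfl rfl ?_ ?_).imp ?_
  -- Before the first round the team already contains its top, which gives the `+ 1` in the size
  -- bound.
  · exact ⟨T, h.setVar (by omega), hT, rfl, Or.inr
      (Finset.card_pos.2 ⟨i, (hT.sound i hT.label_pos).self⟩)⟩
  · rintro m s' hm h8 hf ⟨T', hr, hg, hlab, hor⟩
    have h4 : s'.var 4 = i := (hf.var 4 rfl).trans hi
    refine Runs.seq (Runs.find 0 joinsTest 10 (by omega) hr.bound rfl) ?_
    rintro s1 - ⟨hag, hres⟩
    have hr1 := hr.agree (by omega) hag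
    have h41 : s1.var 4 = i := (hag.var 4 (by omega)).trans h4
    rw [hr.players] at hres
    rcases hres with ⟨h10, hno⟩ | ⟨k, hk, hholds, h10⟩
    · refine Runs.ite (fun h0 => absurd h10 h0) fun _ => Runs.skip ⟨T', hr1.setVar (by omega), hg,
        hlab, Or.inl fun k hk => hno k k.2 ((joins_holds hr hg h4).2 hk)⟩
    · lift k to Fin n using hk
      have hj := (joins_holds hr hg h4).1 hholds
      refine Runs.ite (fun _ => ?_) fun h0 => absurd h0 (by simp [h10])
      refine Runs.store_seq (Runs.store ⟨_, ?_, hg.insert hj, ?_, Or.inr ?_⟩)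
      · refine Represents.setVar ?_ (by omega)
        have hcard := Finset.card_insert_of_notMem hj.notMem
        refine ⟨by simpa using hr1.players, by simpa using hr1.activities, ?_, ?_, ?_, ?_, ?_, ?_⟩
        · intro j
          by_cases hji : j = i <;> simp [hr1.label, Plan.set_label, hji]
        · intro j
          by_cases hji : j = i <;> simp [hr1.act, Plan.set_act, hji]
        · intro j
          by_cases hji : j = i <;>
            simp [hr1.size, Plan.set_team, hji, h41, succ, hcard, Fin.val_inj]
        · intro j k'
          have ht := hr1.table j k'
          by_cases hji : j = i
          · subst hji
            by_cases hkk : k' = k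
            · simp [h41, hr1.row, h10, hkk]
            · simpa [h41, hr1.row, h10, Fin.val_inj, hkk] using ht
          · simpa [h41, hr1.row, h10, index_inj, hji, Plan.set_team hji] using ht
        · intro j
          simp [hr1.row]
        · intro b
          have hu : (T'.set i (T'.label i) (T'.act i) (insert k (T'.team i))).Used b ↔
              T'.Used b := by
            simp [Plan.Used, Plan.set]
          rw [hu]
          simpa using hr1.used b
      · simp [Plan.set, hlab]
      · rw [Plan.set_team_self, Finset.card_insert_of_notMem hj.notMem]
        rcases hor with hor | hor
        · exact absurd hj (hor k)
        · omega
  · rintro s' - ⟨T', hr, hg, hlab, hor⟩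
    -- After `n` rounds the other alternative would be a team of more than `n` players.
    refine ⟨T', hr, hg.valid (Plan.closed_of_not_joins (hor.resolve_right fun hc => ?_)), hlab⟩
    have := (T'.team i).card_le_univ
    rw [h.players] at hc
    rw [Fintype.card_fin] at this
    omega

/-- The array of processed players lists the players labelled `n - x + 1, …, n`. -/
def Listed (s : State) (T : Plan n p) (x : ℕ) : Prop :=
  ∀ l, n - x < l → l ≤ n → ∃ i : Fin n, s.arr 7 l = i ∧ T.label i = l

theorem runs_round {x : ℕ} (hI : I.CopyableAcyclic) (h : Represents s T) (hT : T.Valid I x)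
    (hx : x < n) (h2 : s.var 2 = x) (hlist : Listed s T x) :
    Runs I.oracle (n + p) round s (fun s' => ∃ T' : Plan n p, Represents s' T' ∧
      T'.Valid I (x + 1) ∧ Listed s' T' (x + 1)) := by
  refine Runs.seq (runs_next h hT.toLayout hx hI.2) ?_
  rintro s1 - ⟨hag, i, h10, hi0, hnext⟩
  refine Runs.assign_seq (Runs.assign_seq (Runs.assign_seq (Runs.assign_seq (Runs.assign_seq ?_))))
  set s2 := ((((s1.setVar 4 _).setVar 3 _).setVar 5 _).setVar 6 _).setVar 7 _ with hs2
  have hr2 : Represents s2 T := (((((((h.agree (by omega) hag).setVar (by omega)).setVar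
    (by omega)).setVar (by omega)).setVar (by omega)).setVar (by omega)))
  have h4 : s2.var 4 = i := by simp [hs2, h10]
  have h3 : s2.var 3 = n - x := by
    simp [hs2, hag.var 0 (by omega), hag.var 2 (by omega), h.players, h2]
  have h7a : s2.arr 7 = s.arr 7 := by simp [hs2, hag.arr]
  refine Runs.seq (runs_singles hr2 h4 (by simp [hs2])) ?_
  rintro s3 hf3 ⟨α, h5, hα⟩
  have hr3 : Represents s3 T := hr2.frame hf3 rfl
  refine Runs.seq (runs_children hr3 hT hi0 ((hf3.var 4 rfl).trans h4) h5 hα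
    ((hf3.var 6 rfl).trans (by simp [hs2])) ((hf3.var 7 rfl).trans (by simp [hs2]))) ?_
  rintro s4 hf4 ⟨β, S, hch, hbest⟩
  have hr4 : Represents s4 T := hr3.frame hf4 rfl
  have h44 : s4.var 4 = i := (hf4.var 4 rfl).trans ((hf3.var 4 rfl).trans h4)
  have hrec := runs_record hr4 h44 ((hf4.var 3 rfl).trans ((hf3.var 3 rfl).trans h3)) hi0
    (by omega) hch
  have hgrowing := hT.growing hx hI.1 hi0 hnext hch.start hbest.rational hbest.single
    fun c => hbest.child c c.2
  refine Runs.seq hrec ?_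
  rintro s5 hf5 ⟨hr5, h75⟩
  refine (runs_grow hr5 hgrowing ((hf5.var 4 rfl).trans h44)).imp ?_
  rintro s6 hf6 ⟨T', hr6, hT', hlab⟩
  refine ⟨T', hr6, hT', fun l hl hln => ?_⟩
  rw [hf6.arr 7 rfl, h75, hf4.arr 7 rfl, hf3.arr 7 rfl, h7a, hlab]
  -- The only new entry of the list is the label `n - x` just given out; growing a team leaves
  -- labels and list alone.
  by_cases hlx : l = n - x
  · exact ⟨i, by simp [hlx], by simp [hlx]⟩
  · obtain ⟨j, hj, hjl⟩ := hlist l (by omega) hln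
    have hji : j ≠ i := by
      rintro rfl
      omega
    exact ⟨j, by simp [hlx, hj], by rw [Plan.set_label hji, hjl]⟩

/-- Zeroed memory already represents the plan with nobody processed, except for the row offsets,
which are computed by repeated addition for want of a multiplication instruction. -/
theorem runs_rows : Runs I.oracle (n + p) rows (initState n p)
    (fun s => Represents s (⟨fun _ => 0, fun _ => none, fun _ => ∅⟩ : Plan n p)) := by
  refine (Runs.for (fun m s' => s'.var 9 = m * n ∧ ∀ j < m, s'.arr 5 j = j * n)
    (by simp [initState]) rfl rfl (by simp [initState]) ?_).imp ?_
  · rintro m s' - h2 hf ⟨h9, h5⟩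
    have h0 : s'.var 0 = n := hf.var 0 rfl
    refine Runs.store_seq (Runs.assign ⟨by simp [h9, h0]; ring, fun j hj => ?_⟩)
    by_cases hjm : j = m
    · simp [hjm, h2, h9]
    · simpa [hjm, h2] using h5 j (by omega)
  · rintro s' hf ⟨-, h5⟩
    refine ⟨hf.var 0 rfl, hf.var 1 rfl, fun i => ?_, fun i => ?_, fun i => ?_, fun i k => ?_,
      fun i => h5 i i.2, fun b => ?_⟩
    · rw [hf.arr 1 rfl]; rfl
    · rw [hf.arr 2 rfl]; rfl
    · rw [hf.arr 3 rfl]; rfl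
    · rw [hf.arr 4 rfl]; simp [initState]
    · rw [hf.arr 6 rfl]; simp [initState, Plan.Used]

/-! ### Output of the chosen teams and correctness of the whole program -/

theorem runs_output (h : Represents s T) {i : Fin n} (hi : s.var 4 = i) :
    Runs I.oracle (n + p) output s (fun s' => ∀ k : Fin n,
      s'.arr 0 k = (if k ∈ T.team i then activityCode (T.act i) else s.arr 0 k) ∧
      s'.arr 8 k = if k ∈ T.team i then 1 else s.arr 8 k) := by
  refine (Runs.for (fun m s' => ∀ k : Fin n,
      s'.arr 0 k = (if k.val < m ∧ k ∈ T.team i then activityCode (T.act i) else s.arr 0 k) ∧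
      s'.arr 8 k = if k.val < m ∧ k ∈ T.team i then 1 else s.arr 8 k)
    (h.bound 0 (by omega)) rfl rfl (by simp) ?_).imp ?_
  · intro m s' hm h8 hf hJ
    rw [h.players] at hm
    lift m to Fin n using hm
    have hr : Represents s' T := h.frame hf rfl
    have h4 : s'.var 4 = i := (hf.var 4 rfl).trans hi
    have hent := entry_eval (O := I.oracle) hr (e := .var 4) (f := .var 8) h4 h8
    have hlt : ∀ k : Fin n, k ≠ m → (k.val < m + 1 ↔ k.val < m) := by
      intro k hk
      have := Fin.val_ne_of_ne hk
      omega
    refine Runs.ite (fun h0 => Runs.store_seq (Runs.store fun k => ?_))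
      fun h0 => Runs.skip fun k => ?_
    · have hm := hent.1 h0
      by_cases hkm : k = m
      · simp [h8, h4, hr.act, hkm, hm]
      · simpa [h8, Fin.val_inj, hkm, hlt k hkm] using hJ k
    · have hm := mt hent.2 (not_not.2 h0)
      by_cases hkm : k = m
      · simpa [hkm, hm] using hJ m
      · simpa [hlt k hkm] using hJ k
  · intro s' _ hJ k
    simpa [h.players] using hJ k

/-- Round `m` visits the player labelled `m + 1`, so tops come before everything below them; array
`8` marks exactly the players on which `top` is defined. -/
theorem runs_choose (h : Represents s T) (hT : T.Valid I n) (hlist : Listed s T n)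
    (h8 : ∀ k, s.arr 8 k = 0) :
    Runs I.oracle (n + p) choose s (fun s' => ∃ top, T.Assigning n top ∧
      ∀ k t, top k = some t → s'.arr 0 k = activityCode (T.act t)) := by
  have hdone : ∀ i, T.label i ≠ 0 := by
    have := Finset.filter_card_eq (s := Finset.univ) (p := fun i => T.label i ≠ 0)
      (hT.card.trans (by simp))
    exact fun i => this i (Finset.mem_univ i)
  refine (Runs.for (fun m s' => ∃ top, T.Assigning m top ∧
      (∀ k t, top k = some t → s'.arr 0 k = activityCode (T.act t)) ∧
      ∀ k : Fin n, s'.arr 8 k ≠ 0 ↔ top k ≠ none)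
    (h.bound 0 (by omega)) rfl rfl ?_ ?_).imp ?_
  · exact ⟨fun _ => none, ⟨by simp, by simp, by simp,
      fun i hi => absurd (Nat.le_zero.1 hi) (hdone i)⟩, by simp, by simp [h8]⟩
  · rintro m s' hm h2 hf ⟨top, htop, hout, hasg⟩
    rw [h.players] at hm
    obtain ⟨i, hi7, hil⟩ := hlist (m + 1) (by omega) (by omega)
    refine Runs.assign_seq ?_
    set s1 := s'.setVar 4 _ with hs1
    have h4 : s1.var 4 = i := by
      simp only [hs1, State.setVar_var, if_true, succ, Expr.eval_get, Expr.eval_add, Expr.eval_var,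
        Expr.eval_const, h2, ← hi7]
      rw [hf.arr 7 rfl]
    have hr1 : Represents s1 T := (h.frame hf rfl).setVar (by omega)
    have hasg1 : (Expr.get 8 (.var 4)).eval I.oracle s1 ≠ 0 ↔ top i ≠ none := by
      rw [Expr.eval_get, Expr.eval_var, h4]
      exact hasg i
    refine Runs.ite (fun h0 => Runs.skip ⟨top, htop.skip (fun j hj => ?_) (hasg1.1 h0), hout, hasg⟩)
      fun h0 => ?_
    · exact hT.inj j i (hdone j) (hj.trans hil.symm)
    · have hi0 : top i = none := by
        by_contra hcon
        exact hasg1.2 hcon h0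
      refine (runs_output hr1 h4).imp fun s2 _ h2 => ⟨_, htop.assign hT hdone hil hi0, ?_, ?_⟩
      · intro k t hk
        rw [State.setVar_arr, (h2 k).1]
        split_ifs at hk ⊢ with hki
        · rw [Option.some.inj hk]
        · exact hout k t hk
      · intro k
        rw [State.setVar_arr, (h2 k).2]
        split_ifs with hki
        · simp
        · exact hasg k
  · rintro s' - ⟨top, htop, hout, -⟩
    rw [h.players] at htop
    exact ⟨top, htop, hout⟩

theorem runs_main (hI : I.CopyableAcyclic) :
    Runs I.oracle (n + p) main (initState n p) (fun s => ∃ π : Fin n → Option (Fin p),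
      (∀ i : Fin n, s.arr 0 i = activityCode (π i)) ∧
        I.FeasibleAssignment π ∧ I.IndividuallyStable π) := by
  refine Runs.seq runs_rows fun s1 hf1 hr1 => ?_
  refine Runs.seq (Runs.for (fun m s' => ∃ T : Plan n p, Represents s' T ∧ T.Valid I m ∧
    Listed s' T m) (hr1.bound 0 (by omega)) rfl rfl ?_ ?_) ?_
  -- With nobody processed the invariant is vacuous, and no label lies strictly above `n - 0` and at
  -- most `n`.
  · refine ⟨_, hr1.setVar (by omega), ⟨⟨?_, ?_, ?_, ?_⟩, ?_, ?_, ?_⟩, fun l hl hln => ?_⟩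
    any_goals simp
    omega
  · rintro m s' hm h2 hf ⟨T, hr, hT, hlist⟩
    rw [hr1.players] at hm
    refine (runs_round hI hr hT hm h2 hlist).imp ?_
    rintro s2 - ⟨T', hr', hT', hlist'⟩
    exact ⟨T', hr'.setVar (by omega), hT', hlist'⟩
  · rintro s2 hf2 ⟨T, hr, hT, hlist⟩
    rw [hr1.players] at hT hlist
    refine (runs_choose hr hT hlist fun k => ?_).imp ?_
    · rw [hf2.arr 8 rfl, hf1.arr 8 rfl]
      rfl
    · rintro s3 - ⟨top, htop, hout⟩
      have hsome : ∀ i, ∃ t, top i = some t := fun i => by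
        refine Option.ne_none_iff_exists'.1 (htop.cover i ?_)
        by_cases h0 : T.label i = 0
        · omega
        · exact (hT.range i h0).2
      choose f hf using hsome
      refine ⟨fun i => T.act (f i), fun i => hout i _ (hf i), hT.solution f
        (fun i => htop.mem i _ (hf i)) fun i k hk => ?_⟩
      exact Option.some.inj ((hf k).symm.trans (htop.whole i _ (hf i) k hk))

end Algorithm

end GGASP

theorem mainTheorem12 :
    (∀ (n p : ℕ) (I : GGASP n p), I.CopyableAcyclic →
      ∃ π : Fin n → Option (Fin p), I.FeasibleAssignment π ∧ I.IndividuallyStable π) ∧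
    (∃ (c : RAM.Prog) (P : MvPolynomial (Fin 2) ℕ),
      ∀ (n p : ℕ) (I : GGASP n p), I.CopyableAcyclic →
        ∃ (t : ℕ) (π : Fin n → Option (Fin p)),
          GGASP.Computes c I t π ∧ t ≤ MvPolynomial.eval ![p, n] P ∧
          I.FeasibleAssignment π ∧ I.IndividuallyStable π) := by
  constructor
  · intro n p I hI
    obtain ⟨-, -, -, -, π, -, h⟩ := GGASP.Algorithm.runs_main hI
    exact ⟨π, h⟩
  · obtain ⟨q, hq⟩ := GGASP.Algorithm.main.exists_polynomial_bound
    -- The one-variable bound is evaluated at `n + p`; under `![p, n]` the variable `X 1` stands for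
    -- `n` and `X 0` for `p`.
    refine ⟨GGASP.Algorithm.main, Polynomial.aeval (MvPolynomial.X 1 + MvPolynomial.X 0) q, ?_⟩
    intro n p I hI
    obtain ⟨t, s, hexec, ht, π, hout, h⟩ := GGASP.Algorithm.runs_main hI
    refine ⟨t, π, ⟨s, hexec, hout⟩, ht.trans (le_of_eq ?_), h⟩
    rw [hq, Polynomial.aeval_def, Polynomial.hom_eval₂]
    have : (MvPolynomial.eval ![p, n]).comp
        (algebraMap ℕ (MvPolynomial (Fin 2) ℕ)) = RingHom.id ℕ := Subsingleton.elim _ _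
    rw [this]
    simp [Polynomial.eval₂_id]
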